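/- For a rational point $x\in\mathbb{P}^3(\mathbb{Q})$, written $x=[x_1,x_2,x_3,x_4]$ with $x_1,\ldots,x_4\in\mathbb{Z}$ and $\gcd(x_1,x_2,x_3,x_4)=1$, let $H(x)=\max_{1\le i\le 4}|x_i|$. Let $$S_2=\{[x_1,x_2,x_3,x_4]\in\mathbb{P}^3:\ x_1x_2(x_1+x_2)+x_4(x_1+x_2+x_3)^2=0\}$$ be the split cubic surface with a $\mathbf{D}_4$ singularity, and let $U\subset S_2$ be the open subset formed by deleting all lines (defined over $\overline{\mathbb{Q}}$) contained in $S_2$; these are the six lines $x_i=x_4=0$, $x_1+x_2=x_j=0$ and $x_i=x_1+x_2+x_3=0$ for $i\in\{1,2\}$, $j\in\{3,4\}$. Then for every real $B$ the set $\{x\in U(\mathbb{Q}):H(x)\le B\}$ is finite, and its cardinality $N_U(B)$ satisfies $$N_U(B)\ll B(\log B)^6,$$ that is, there are constants $C>0$ and $B_0$ such that $N_U(B)\le C\,B(\log B)^6$ for all real $B\ge B_0$. -/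

import Mathlib

open scoped LinearAlgebra.Projectivization

namespace D4Cubic

/-- An integer vector is primitive when its components share no common factor. -/
def IsPrimitive {n : ℕ} (z : Fin n → ℤ) : Prop :=
  Finset.univ.gcd z = 1

/-- The norm `|z| = max |z i|` of an integer vector. -/
def maxNorm {n : ℕ} (z : Fin n → ℤ) : ℕ :=
  Finset.univ.sup fun i => (z i).natAbs

/-- The integer vector `z` is a representative of the rational projective point `x`. -/
def Represents {n : ℕ} (z : Fin n → ℤ) (x : ℙ ℚ (Fin n → ℚ)) : Prop :=
  ∃ h : (fun i => (z i : ℚ)) ≠ 0, Projectivization.mk ℚ (fun i => (z i : ℚ)) h = x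

theorem exists_primitive_represents {n : ℕ} (x : ℙ ℚ (Fin n → ℚ)) :
    ∃ z : Fin n → ℤ, IsPrimitive z ∧ Represents z x := by
  obtain ⟨b, hb⟩ := IsLocalization.exist_integer_multiples_of_finite
    (nonZeroDivisors ℤ) x.rep
  choose w hw using hb
  have hb0 : (b : ℤ) ≠ 0 := nonZeroDivisors.coe_ne_zero b
  have hw' : ∀ i, (w i : ℚ) = (b : ℤ) * x.rep i := by
    intro i
    have := hw i
    simpa using this
  obtain ⟨j, hj⟩ : ∃ j, x.rep j ≠ 0 := by
    by_contra! h
    exact x.rep_nonzero (funext h)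
  have hwj : w j ≠ 0 := by
    intro h
    have := hw' j
    rw [h] at this
    have hbq : ((b : ℤ) : ℚ) ≠ 0 := by exact_mod_cast hb0
    simp_all
  obtain ⟨z, hz, hg⟩ := Finset.extract_gcd w ⟨j, Finset.mem_univ j⟩
  set g := Finset.univ.gcd w with hgdef
  have hg0 : g ≠ 0 := fun h => hwj (by rw [hz j (Finset.mem_univ j), h, zero_mul])
  have hgq : (g : ℚ) ≠ 0 := by exact_mod_cast hg0
  have hbq : ((b : ℤ) : ℚ) ≠ 0 := by exact_mod_cast hb0
  have hzr : (fun i => (z i : ℚ)) = (((b : ℤ) : ℚ) / g) • x.rep := by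
    funext i
    have h1 : (w i : ℚ) = g * z i := by exact_mod_cast hz i (Finset.mem_univ i)
    have h2 := hw' i
    simp only [Pi.smul_apply, smul_eq_mul]
    field_simp
    rw [mul_comm, ← h1, h2]
  have hne : (fun i => (z i : ℚ)) ≠ 0 := by
    rw [hzr]
    exact smul_ne_zero (div_ne_zero hbq hgq) x.rep_nonzero
  refine ⟨z, hg, hne, ?_⟩
  conv_rhs => rw [← x.mk_rep]
  rw [Projectivization.mk_eq_mk_iff']
  exact ⟨_, hzr.symm⟩

/-- The height of a rational projective point: the norm of a primitive integer representative. -/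
noncomputable def height {n : ℕ} (x : ℙ ℚ (Fin n → ℚ)) : ℕ :=
  maxNorm (exists_primitive_represents x).choose

theorem dvd_of_primitive {n : ℕ} {z w : Fin n → ℤ} (hz : IsPrimitive z) {a b : ℤ}
    (h : ∀ i, a * z i = b * w i) : b ∣ a := by
  have h1 : b ∣ Finset.univ.gcd fun i => a * z i :=
    Finset.dvd_gcd fun i _ => ⟨w i, h i⟩
  rw [Finset.gcd_mul_left, show Finset.univ.gcd z = 1 from hz, mul_one] at h1
  exact (dvd_normalize_iff).1 h1

/-- The height does not depend on the choice of the primitive representative. -/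
theorem height_eq {n : ℕ} {x : ℙ ℚ (Fin n → ℚ)} {z : Fin n → ℤ}
    (hz : IsPrimitive z) (hx : Represents z x) : height x = maxNorm z := by
  obtain ⟨hw, hw0, hwx⟩ := (exists_primitive_represents x).choose_spec
  obtain ⟨hz0, hzx⟩ := hx
  unfold height
  generalize (exists_primitive_represents x).choose = w at hw hw0 hwx ⊢
  have hwx := hwx.trans hzx.symm
  rw [Projectivization.mk_eq_mk_iff'] at hwx
  obtain ⟨q, hq⟩ := hwx
  have key : ∀ i, q.num * z i = (q.den : ℤ) * w i := by
    intro i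
    have h1 : q * z i = w i := congrFun hq i
    have h2 : (q.num : ℚ) = q * q.den := (Rat.mul_den_eq_num q).symm
    have : (q.num : ℚ) * z i = q.den * w i := by
      rw [h2, ← h1]
      ring
    exact_mod_cast this
  have d1 := dvd_of_primitive hz key
  have d2 := dvd_of_primitive hw fun i => (key i).symm
  have hab : q.num.natAbs = q.den := by
    have := Int.natAbs_eq_of_dvd_dvd d2 d1
    simpa using this
  unfold maxNorm
  congr 1
  funext i
  have h3 := congrArg Int.natAbs (key i)
  rw [Int.natAbs_mul, Int.natAbs_mul, hab, Int.natAbs_natCast] at h3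
  exact (Nat.eq_of_mul_eq_mul_left q.den_pos h3).symm

/-- The vector `v` is a zero of the form `F` over a ring `R`. -/
def IsZero {n : ℕ} (F : MvPolynomial (Fin n) ℤ) {R : Type*} [CommRing R] (v : Fin n → R) : Prop :=
  MvPolynomial.aeval v F = 0

/-- `W`, a two-dimensional subspace of `n`-space over the algebraic numbers and hence a line in
projective space, is contained in the hypersurface `F = 0`. -/
def IsLineOn {n : ℕ} (F : MvPolynomial (Fin n) ℤ)
    (W : Submodule (AlgebraicClosure ℚ) (Fin n → AlgebraicClosure ℚ)) : Prop :=
  Module.finrank (AlgebraicClosure ℚ) W = 2 ∧ ∀ v ∈ W, IsZero F v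

/-- The rational points of the open subset of the hypersurface `F = 0` (with `F` homogeneous)
formed by deleting all lines, over the algebraic numbers, that it contains. -/
def pointsOffLines {n : ℕ} (F : MvPolynomial (Fin n) ℤ) : Set (ℙ ℚ (Fin n → ℚ)) :=
  {x | IsZero F x.rep ∧ ∀ W, IsLineOn F W →
    (fun i => algebraMap ℚ (AlgebraicClosure ℚ) (x.rep i)) ∉ W}

/-- The points of height at most `B` in a set of rational points. -/
def pointsUpTo {n : ℕ} (U : Set (ℙ ℚ (Fin n → ℚ))) (B : ℝ) : Set (ℙ ℚ (Fin n → ℚ)) :=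
  {x | x ∈ U ∧ (height x : ℝ) ≤ B}

/-- The counting function `N_U(B)`. -/
noncomputable def countingFunction {n : ℕ} (U : Set (ℙ ℚ (Fin n → ℚ))) (B : ℝ) : ℕ :=
  (pointsUpTo U B).ncard

/-- The form `x₁x₂(x₁+x₂) + x₄(x₁+x₂+x₃)²`; the coordinates `x₁, …, x₄` have indices `0, …, 3`. -/
noncomputable def d4Form : MvPolynomial (Fin 4) ℤ :=
  MvPolynomial.X 0 * MvPolynomial.X 1 * (MvPolynomial.X 0 + MvPolynomial.X 1) +
    MvPolynomial.X 3 * (MvPolynomial.X 0 + MvPolynomial.X 1 + MvPolynomial.X 2) ^ 2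

theorem isZero_d4Form_iff {R : Type*} [CommRing R] (v : Fin 4 → R) :
    IsZero d4Form v ↔ v 0 * v 1 * (v 0 + v 1) + v 3 * (v 0 + v 1 + v 2) ^ 2 = 0 := by
  simp [IsZero, d4Form]

/-- A line on the surface through a point `p` with `x₄ ≠ 0` and `x₁ + x₂ + x₃ ≠ 0` degenerates. -/
theorem d4_direction {K : Type*} [Field K] [CharZero K] {p q : Fin 4 → K}
    (hp3 : p 3 ≠ 0) (hps : p 0 + p 1 + p 2 ≠ 0)
    (h : ∀ r t : K, IsZero d4Form (r • p + t • q)) : ∃ r : K, q = r • p := by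
  obtain ⟨m, hm⟩ : ∃ m : K, m * (p 0 + p 1 + p 2) = q 0 + q 1 + q 2 :=
    ⟨(q 0 + q 1 + q 2) / (p 0 + p 1 + p 2), div_mul_cancel₀ _ hps⟩
  refine ⟨m, ?_⟩
  have e0 := h 1 0
  have e1 := h (1 - m) 1
  have e2 := h (1 + m) (-1)
  have e3 := h (-m) 1
  simp only [isZero_d4Form_iff, Pi.add_apply, Pi.smul_apply, smul_eq_mul] at e0 e1 e2 e3
  obtain ⟨A, hA⟩ : ∃ A, A = q 0 - m * p 0 := ⟨_, rfl⟩
  obtain ⟨B, hB⟩ : ∃ B, B = q 1 - m * p 1 := ⟨_, rfl⟩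
  obtain ⟨D, hD⟩ : ∃ D, D = q 3 - m * p 3 := ⟨_, rfl⟩
  have q0 : q 0 = A + m * p 0 := by rw [hA]; ring
  have q1 : q 1 = B + m * p 1 := by rw [hB]; ring
  have q3 : q 3 = D + m * p 3 := by rw [hD]; ring
  have q2 : q 2 = m * p 2 - A - B := by linear_combination (-1 : K) * hm - q0 - q1
  have hprod : p 0 * p 1 * (p 0 + p 1) ≠ 0 := by
    intro hh
    refine mul_ne_zero hp3 (pow_ne_zero 2 hps) ?_
    linear_combination e0 - hh
  have ha : p 0 ≠ 0 := fun hh => hprod (by rw [hh]; ring)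
  have hb : p 1 ≠ 0 := fun hh => hprod (by rw [hh]; ring)
  have hc : p 0 + p 1 ≠ 0 := fun hh => hprod (by rw [hh]; ring)
  rw [q0, q1, q2, q3] at e1 e2 e3
  have f3 : A * B * (A + B) = 0 := by linear_combination e3
  have f2 : p 0 * B * (A + B) + p 1 * A * (A + B) + (p 0 + p 1) * A * B = 0 := by
    have : (2 : K) * (p 0 * B * (A + B) + p 1 * A * (A + B) + (p 0 + p 1) * A * B) = 0 := by
      linear_combination e1 + e2 - 2 * e0
    exact (mul_eq_zero.1 this).resolve_left two_ne_zero
  have f1 : A * p 1 * (p 0 + p 1) + B * p 0 * (p 0 + p 1) + (A + B) * (p 0 * p 1) +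
      D * (p 0 + p 1 + p 2) ^ 2 = 0 := by
    have : (2 : K) * (A * p 1 * (p 0 + p 1) + B * p 0 * (p 0 + p 1) + (A + B) * (p 0 * p 1) +
      D * (p 0 + p 1 + p 2) ^ 2) = 0 := by
      linear_combination e1 - e2 - 2 * f3
    exact (mul_eq_zero.1 this).resolve_left two_ne_zero
  have hAB : A = 0 ∧ B = 0 := by
    rcases mul_eq_zero.1 f3 with f3 | f3
    · rcases mul_eq_zero.1 f3 with f3 | f3
      · have : p 0 * B ^ 2 = 0 := by rw [f3] at f2; linear_combination f2
        exact ⟨f3, pow_eq_zero_iff two_ne_zero |>.1 ((mul_eq_zero.1 this).resolve_left ha)⟩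
      · have : p 1 * A ^ 2 = 0 := by rw [f3] at f2; linear_combination f2
        exact ⟨pow_eq_zero_iff two_ne_zero |>.1 ((mul_eq_zero.1 this).resolve_left hb), f3⟩
    · have hBA : B = -A := by linear_combination f3
      have : (p 0 + p 1) * A ^ 2 = 0 := by rw [hBA] at f2; linear_combination -f2
      have hA0 := pow_eq_zero_iff two_ne_zero |>.1 ((mul_eq_zero.1 this).resolve_left hc)
      exact ⟨hA0, by rw [hBA, hA0, neg_zero]⟩
  obtain ⟨hA0, hB0⟩ := hAB
  have hD0 : D = 0 := by
    rw [hA0, hB0] at f1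
    have : D * (p 0 + p 1 + p 2) ^ 2 = 0 := by linear_combination f1
    exact (mul_eq_zero.1 this).resolve_right (pow_ne_zero 2 hps)
  funext i
  fin_cases i
  · simp [q0, hA0]
  · simp [q1, hB0]
  · simp [q2, hA0, hB0]
  · simp [q3, hD0]

theorem finrank_span_pair_eq_two {K : Type*} [Field K] {u v : Fin 4 → K}
    (h : LinearIndependent K ![u, v]) :
    Module.finrank K (Submodule.span K {u, v}) = 2 := by
  have h1 := finrank_span_eq_card h
  have h2 : Set.range ![u, v] = {u, v} := by
    rw [Matrix.range_cons, Matrix.range_cons, Matrix.range_empty, Set.union_empty]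
    rfl
  rw [h2] at h1
  simpa using h1

/-- Points of the surface `d4Form = 0` lie off all of its lines exactly when they lie off the six lines
`xᵢ = x₄ = 0`, `x₁ + x₂ = xⱼ = 0`, `xᵢ = x₁ + x₂ + x₃ = 0` for `i ∈ {1, 2}`, `j ∈ {3, 4}`. -/
theorem mem_pointsOffLines_d4Form (x : ℙ ℚ (Fin 4 → ℚ)) :
    x ∈ pointsOffLines d4Form ↔ IsZero d4Form x.rep ∧
      ¬(x.rep 0 = 0 ∧ x.rep 3 = 0) ∧ ¬(x.rep 1 = 0 ∧ x.rep 3 = 0) ∧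
      ¬(x.rep 0 + x.rep 1 = 0 ∧ x.rep 2 = 0) ∧ ¬(x.rep 0 + x.rep 1 = 0 ∧ x.rep 3 = 0) ∧
      ¬(x.rep 0 = 0 ∧ x.rep 0 + x.rep 1 + x.rep 2 = 0) ∧
      ¬(x.rep 1 = 0 ∧ x.rep 0 + x.rep 1 + x.rep 2 = 0) := by
  set K := AlgebraicClosure ℚ
  set p : Fin 4 → K := fun i => algebraMap ℚ K (x.rep i) with hp
  constructor
  · rintro ⟨hz, hl⟩
    -- a span of two vectors on which the form vanishes, and which contains the point
    have key : ∀ u v : Fin 4 → K, LinearIndependent K ![u, v] →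
        (∀ a b : K, IsZero d4Form (a • u + b • v)) → (∃ a b : K, a • u + b • v = p) → False := by
      intro u v hi hF hpm
      refine hl (Submodule.span K {u, v}) ⟨finrank_span_pair_eq_two hi, ?_⟩
        (Submodule.mem_span_pair.2 hpm)
      intro y hy
      obtain ⟨a, b, rfl⟩ := Submodule.mem_span_pair.1 hy
      exact hF a b
    refine ⟨hz, ?_, ?_, ?_, ?_, ?_, ?_⟩ <;> rintro ⟨h1, h2⟩
    · refine key ![0, 1, 0, 0] ![0, 0, 1, 0] ?_ ?_ ⟨p 1, p 2, ?_⟩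
      · rw [LinearIndependent.pair_iff]
        intro s t h
        exact ⟨by simpa using congrFun h 1, by simpa using congrFun h 2⟩
      · intro a b
        simp [isZero_d4Form_iff]
      · funext i
        fin_cases i <;> simp [hp, h1, h2]
    · refine key ![1, 0, 0, 0] ![0, 0, 1, 0] ?_ ?_ ⟨p 0, p 2, ?_⟩
      · rw [LinearIndependent.pair_iff]
        intro s t h
        exact ⟨by simpa using congrFun h 0, by simpa using congrFun h 2⟩
      · intro a b
        simp [isZero_d4Form_iff]
      · funext i
        fin_cases i <;> simp [hp, h1, h2]
    · refine key ![1, -1, 0, 0] ![0, 0, 0, 1] ?_ ?_ ⟨p 0, p 3, ?_⟩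
      · rw [LinearIndependent.pair_iff]
        intro s t h
        exact ⟨by simpa using congrFun h 0, by simpa using congrFun h 3⟩
      · intro a b
        have e : a + a * -1 = 0 := by ring
        simp [isZero_d4Form_iff, e]
      · have h3 : x.rep 1 = -x.rep 0 := by linarith
        funext i
        fin_cases i <;> simp [hp, h3, h2] <;> ring
    · refine key ![1, -1, 0, 0] ![0, 0, 1, 0] ?_ ?_ ⟨p 0, p 2, ?_⟩
      · rw [LinearIndependent.pair_iff]
        intro s t h
        exact ⟨by simpa using congrFun h 0, by simpa using congrFun h 2⟩
      · intro a b
        have e : a + a * -1 = 0 := by ring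
        simp [isZero_d4Form_iff, e]
      · have h3 : x.rep 1 = -x.rep 0 := by linarith
        funext i
        fin_cases i <;> simp [hp, h3, h2] <;> ring
    · refine key ![0, 1, -1, 0] ![0, 0, 0, 1] ?_ ?_ ⟨p 1, p 3, ?_⟩
      · rw [LinearIndependent.pair_iff]
        intro s t h
        exact ⟨by simpa using congrFun h 1, by simpa using congrFun h 3⟩
      · intro a b
        have e : a + a * -1 = 0 := by ring
        simp [isZero_d4Form_iff, e]
      · have h3 : x.rep 2 = -x.rep 1 := by linarith
        funext i
        fin_cases i <;> simp [hp, h3, h1] <;> ring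
    · refine key ![1, 0, -1, 0] ![0, 0, 0, 1] ?_ ?_ ⟨p 0, p 3, ?_⟩
      · rw [LinearIndependent.pair_iff]
        intro s t h
        exact ⟨by simpa using congrFun h 0, by simpa using congrFun h 3⟩
      · intro a b
        have e : a + a * -1 = 0 := by ring
        simp [isZero_d4Form_iff, e]
      · have h3 : x.rep 2 = -x.rep 0 := by linarith
        funext i
        fin_cases i <;> simp [hp, h3, h1] <;> ring
  · rintro ⟨hz, l1, l2, l3, l4, l5, l6⟩
    refine ⟨hz, ?_⟩
    rintro W ⟨hW2, hWF⟩ hpW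
    have hz' := (isZero_d4Form_iff _).1 hz
    have hr3 : x.rep 3 ≠ 0 := by
      intro h
      rw [h, zero_mul, add_zero] at hz'
      rcases mul_eq_zero.1 hz' with hz' | hz'
      · rcases mul_eq_zero.1 hz' with hz' | hz'
        · exact l1 ⟨hz', h⟩
        · exact l2 ⟨hz', h⟩
      · exact l4 ⟨hz', h⟩
    have hrs : x.rep 0 + x.rep 1 + x.rep 2 ≠ 0 := by
      intro h
      rw [h, zero_pow two_ne_zero, mul_zero, add_zero] at hz'
      rcases mul_eq_zero.1 hz' with hz' | hz'
      · rcases mul_eq_zero.1 hz' with hz' | hz'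
        · exact l5 ⟨hz', h⟩
        · exact l6 ⟨hz', h⟩
      · exact l3 ⟨hz', by rw [hz', zero_add] at h; exact h⟩
    have inj := FaithfulSMul.algebraMap_injective ℚ K
    have hp3 : p 3 ≠ 0 := (map_ne_zero_iff _ inj).2 hr3
    have hps : p 0 + p 1 + p 2 ≠ 0 := by
      have := (map_ne_zero_iff _ inj).2 hrs
      simp only [map_add] at this
      exact this
    have hle : W ≤ Submodule.span K {p} := by
      intro q hq
      obtain ⟨r, hr⟩ := d4_direction (p := p) (q := q) hp3 hps fun r t =>
        hWF _ (W.add_mem (W.smul_mem r hpW) (W.smul_mem t hq))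
      exact Submodule.mem_span_singleton.2 ⟨r, hr.symm⟩
    have h1 := Submodule.finrank_mono hle
    have h2 : Module.finrank K (Submodule.span K {p}) ≤ 1 := by
      simpa using finrank_span_le_card (R := K) ({p} : Set (Fin 4 → K))
    exact absurd (hW2.symm.le.trans (h1.trans h2)) (by norm_num)

end D4Cubic

/-!
# Points of bounded height on the split cubic surface with a `D₄` singularity

With `a = x₁`, `b = x₂`, `c = x₁ + x₂ + x₃`, `d = x₄` the surface is `a b (a + b) = -d c²`, and
off the lines all of these numbers are nonzero. Up to signs and a permutation, a primitive
solution factors uniformly (`exists_torsor`): with `W = w₀ w₁ w₂` and pairwise coprime terms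
`tⱼ = wⱼ yⱼ² zⱼ`,

  `a = s u² W t₀`, `b = s u² W t₁`, `a + b = s u² W t₂`, `c = u³ W² y₀ y₁ y₂`, `d = s³ z₀ z₁ z₂`,

so that everything is governed by the torsor equation `t₀ + t₁ = t₂` and the bounds
`a + b, c, d ≤ N`.

The variables are put into dyadic boxes, where the torsor equation is counted in two ways. As a
linear equation in `z` it is a congruence for `z₀ / z₁` modulo `w₂ y₂²`, and distinct such
fractions are far apart (`card_linear_le`). As a conic in `y`, its solutions fall into a number of
classes bounded by divisor functions; three solutions in one class have a determinant divisible by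
the discriminant of the conic, whereas on a short arc of the conic determinants are small
(`card_conic_le`).

The main term of the linear bound, of order `c d / (a s²)` after scaling out `s`, adds up to
`N (log N)⁶`: the six logarithms come from `u`, the three `wⱼ`, and two of the `yⱼ`, since the
sizes of `c`, `d` and of the largest term are then forced to be near their extremes. Its error
term, one for each `(u, w, y)`, is harmless for fixed `s`, but not in the sum over `s`, where
points with large `s` have small `z`. There the conic bound takes over: it gains powers of `s`, of
`u` and of `w`, and loses six logarithms. Geometric means of the two with weights `3/5, 2/5` and
`1/3, 2/3` keep a factor `s` to the power `-6/5` or better and at most `(log N)⁶`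
(`torsorCount_le_rpow`, `exists_sum_torsorCount_le`).
-/

namespace D4Cubic

/-! ### Torsor coordinates -/

/-- A point of the universal torsor over the surface, with the coordinates `s` and `u`, which only
scale the point, left out: coefficient triples `w`, `y`, `z` for which the three terms `wⱼ yⱼ² zⱼ`
are pairwise coprime and the first two add up to the third. -/
def IsTorsorPoint (w y z : Fin 3 → ℕ) : Prop :=
  w 0 * y 0 ^ 2 * z 0 + w 1 * y 1 ^ 2 * z 1 = w 2 * y 2 ^ 2 * z 2 ∧
    Nat.Coprime (w 0 * y 0 ^ 2 * z 0) (w 1 * y 1 ^ 2 * z 1) ∧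
    Nat.Coprime (w 0 * y 0 ^ 2 * z 0) (w 2 * y 2 ^ 2 * z 2) ∧
    Nat.Coprime (w 1 * y 1 ^ 2 * z 1) (w 2 * y 2 ^ 2 * z 2)

/-- The number `g` splits into a part coprime to `c` and a part composed of primes dividing `c`.
-/
theorem exists_coprime_mul_of_prime_dvd (c g : ℕ) (hg : 0 < g) :
    ∃ s h : ℕ, g = s * h ∧ s.Coprime c ∧ ∀ p : ℕ, p.Prime → p ∣ h → p ∣ c := by
  induction g using Nat.strong_induction_on with
  | _ g ih =>
    by_cases hc : g.Coprime c
    · exact ⟨g, 1, by simp, hc, fun p hp h => absurd (Nat.dvd_one.1 h) hp.one_lt.ne'⟩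
    · obtain ⟨g₁, hg₁⟩ := Nat.gcd_dvd_left g c
      have ht : 1 < g.gcd c := by
        have := Nat.gcd_pos_of_pos_left c hg
        have : g.gcd c ≠ 1 := hc
        omega
      have hg₁0 : 0 < g₁ := by
        rcases Nat.eq_zero_or_pos g₁ with h | h
        · rw [h, mul_zero] at hg₁; omega
        · exact h
      have hlt : g₁ < g := by
        calc g₁ < g.gcd c * g₁ := by nlinarith
          _ = g := hg₁.symm
      obtain ⟨s, h, h1, h2, h3⟩ := ih g₁ hlt hg₁0
      refine ⟨s, h * g.gcd c, ?_, h2, fun p hp hd => ?_⟩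
      · calc g = g.gcd c * g₁ := hg₁
          _ = s * (h * g.gcd c) := by rw [h1]; ring
      · rcases (hp.dvd_mul).1 hd with hd | hd
        · exact h3 p hp hd
        · exact hd.trans (Nat.gcd_dvd_right g c)

theorem eq_gcd_mul_gcd_mul_gcd {a b e n : ℕ} (hab : a.Coprime b) (hae : a.Coprime e)
    (hbe : b.Coprime e) (hn : n ∣ a * b * e) : n = n.gcd a * n.gcd b * n.gcd e := by
  rw [← Nat.Coprime.gcd_mul n hab, ← Nat.Coprime.gcd_mul n (Nat.Coprime.mul_left hae hbe)]
  exact (Nat.gcd_eq_left hn).symm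

/-- The torsor coordinates when `a` and `b` are coprime: a divisor of the product of `a`, `b` and
`e` is the product of its gcds with the three factors. -/
theorem exists_torsor_of_coprime {a b e v k d : ℕ} (ha : 0 < a) (hb : 0 < b) (he : 0 < e)
    (hsum : a + b = e) (hab : a.Coprime b) (h : a * b * e = d * v * k ^ 2) :
    ∃ w y z : Fin 3 → ℕ, v = w 0 * w 1 * w 2 ∧ k = y 0 * y 1 * y 2 ∧ d = z 0 * z 1 * z 2 ∧
      a = w 0 * y 0 ^ 2 * z 0 ∧ b = w 1 * y 1 ^ 2 * z 1 ∧ e = w 2 * y 2 ^ 2 * z 2 ∧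
      IsTorsorPoint w y z := by
  have hae : a.Coprime e := by rw [← hsum]; simpa using hab
  have hbe : b.Coprime e := by rw [← hsum]; simpa using hab.symm
  have hv : v ∣ a * b * e := ⟨d * k ^ 2, by rw [h]; ring⟩
  have hk : k ∣ a * b * e := ⟨d * v * k, by rw [h]; ring⟩
  have hv' := eq_gcd_mul_gcd_mul_gcd hab hae hbe hv
  have hk' := eq_gcd_mul_gcd_mul_gcd hab hae hbe hk
  have hvk : v * k ^ 2 ∣ a * b * e := ⟨d, by rw [h]; ring⟩
  have hpos : 0 < a * b * e := by positivity
  have key : ∀ m : ℕ, v.gcd m * k.gcd m ^ 2 ∣ v * k ^ 2 := fun m =>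
    mul_dvd_mul (Nat.gcd_dvd_left _ _) (pow_dvd_pow_of_dvd (Nat.gcd_dvd_left _ _) 2)
  have cop : ∀ m n : ℕ, m.Coprime n → (v.gcd m * k.gcd m ^ 2).Coprime n := fun m n hmn =>
    Nat.Coprime.mul_left (hmn.coprime_dvd_left (Nat.gcd_dvd_right _ _))
      ((hmn.coprime_dvd_left (Nat.gcd_dvd_right _ _)).pow_left 2)
  obtain ⟨z₀, h₀⟩ : v.gcd a * k.gcd a ^ 2 ∣ a :=
    (cop a b hab).dvd_of_dvd_mul_right
      ((cop a e hae).dvd_of_dvd_mul_right ((key a).trans hvk))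
  obtain ⟨z₁, h₁⟩ : v.gcd b * k.gcd b ^ 2 ∣ b :=
    (cop b a hab.symm).dvd_of_dvd_mul_left
      ((cop b e hbe).dvd_of_dvd_mul_right ((key b).trans hvk))
  obtain ⟨z₂, h₂⟩ : v.gcd e * k.gcd e ^ 2 ∣ e :=
    (cop e _ (Nat.Coprime.mul_left hae hbe).symm).dvd_of_dvd_mul_left ((key e).trans hvk)
  refine ⟨![v.gcd a, v.gcd b, v.gcd e], ![k.gcd a, k.gcd b, k.gcd e], ![z₀, z₁, z₂], ?_⟩
  simp only [IsTorsorPoint, Matrix.cons_val_zero, Matrix.cons_val_one, Matrix.cons_val]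
  rw [← h₀, ← h₁, ← h₂]
  refine ⟨hv', hk', ?_, rfl, rfl, rfl, hsum, hab, hae, hbe⟩
  have hvk0 : 0 < v * k ^ 2 := Nat.pos_of_dvd_of_pos hvk hpos
  refine Nat.eq_of_mul_eq_mul_right hvk0 ?_
  calc d * (v * k ^ 2) = a * b * e := by rw [h]; ring
    _ = (v.gcd a * k.gcd a ^ 2 * z₀) * (v.gcd b * k.gcd b ^ 2 * z₁) *
        (v.gcd e * k.gcd e ^ 2 * z₂) := by rw [← h₀, ← h₁, ← h₂]
    _ = z₀ * z₁ * z₂ * ((v.gcd a * v.gcd b * v.gcd e) * (k.gcd a * k.gcd b * k.gcd e) ^ 2) := by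
        ring
    _ = _ := by rw [← hv', ← hk']

/-- Every solution of `a b (a + b) = d c²` without a common prime factor comes from the torsor.
The gcd of `a` and `b` is `s u² v` with `s` coprime to `c`, `u² v` coprime to `d` and `v`
squarefree; comparing prime powers gives `s³ ∣ d` and `u³ v² ∣ c`, and the remaining equation has
coprime `a` and `b`. -/
theorem exists_torsor {a b c d : ℕ} (ha : 0 < a) (hb : 0 < b)
    (h : a * b * (a + b) = d * c ^ 2)
    (hg : ∀ p : ℕ, p.Prime → p ∣ a → p ∣ b → p ∣ c → ¬ p ∣ d) :
    ∃ (s u : ℕ) (w y z : Fin 3 → ℕ),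
      a = s * u ^ 2 * (w 0 * w 1 * w 2) * (w 0 * y 0 ^ 2 * z 0) ∧
      b = s * u ^ 2 * (w 0 * w 1 * w 2) * (w 1 * y 1 ^ 2 * z 1) ∧
      a + b = s * u ^ 2 * (w 0 * w 1 * w 2) * (w 2 * y 2 ^ 2 * z 2) ∧
      c = u ^ 3 * (w 0 * w 1 * w 2) ^ 2 * (y 0 * y 1 * y 2) ∧
      d = s ^ 3 * (z 0 * z 1 * z 2) ∧ IsTorsorPoint w y z := by
  have hg0 : 0 < a.gcd b := Nat.gcd_pos_of_pos_left b ha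
  obtain ⟨s, k, hsk, hsc, hkc⟩ := exists_coprime_mul_of_prime_dvd c _ hg0
  obtain ⟨a', b', hab, ha', hb'⟩ := Nat.exists_coprime a b
  rw [hsk] at ha' hb' hg0
  have hs0 : 0 < s := Nat.pos_of_ne_zero fun h => by simp [h] at hg0
  have hk0 : 0 < k := Nat.pos_of_ne_zero fun h => by simp [h] at hg0
  have ha0 : 0 < a' := Nat.pos_of_ne_zero fun h => by simp [h] at ha'; omega
  have hb0 : 0 < b' := Nat.pos_of_ne_zero fun h => by simp [h] at hb'; omega
  have hkd : k.Coprime d := by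
    refine Nat.Coprime.symm (Nat.coprime_of_dvd fun p hp h1 h2 => ?_)
    have hpk : p ∣ s * k := h2.mul_left s
    exact hg p hp (ha' ▸ hpk.mul_left a') (hb' ▸ hpk.mul_left b') (hkc p hp h2) h1
  -- the part of the gcd coprime to `c` is absorbed by `d`
  have e1 : s ^ 3 * (k ^ 3 * (a' * b' * (a' + b'))) = d * c ^ 2 := by
    rw [← h, ha', hb']; ring
  obtain ⟨d', hd'⟩ : s ^ 3 ∣ d :=
    (hsc.pow 3 2).dvd_of_dvd_mul_right ⟨_, e1.symm⟩
  have e2 : k ^ 3 * (a' * b' * (a' + b')) = d' * c ^ 2 := by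
    refine Nat.eq_of_mul_eq_mul_left (pow_pos hs0 3) ?_
    rw [e1, hd']; ring
  -- the part coprime to `d` is absorbed by `c`
  have hk3 : k ^ 3 ∣ c ^ 2 := by
    have : k.Coprime d' := hkd.coprime_dvd_right ⟨s ^ 3, by rw [hd']; ring⟩
    exact (this.pow_left 3).dvd_of_dvd_mul_left ⟨_, e2.symm⟩
  obtain ⟨v, u, huv, hv⟩ := Nat.sq_mul_squarefree k
  have hu0 : 0 < u := Nat.pos_of_ne_zero fun h => by simp [h] at huv; omega
  have hv0 : 0 < v := Nat.pos_of_ne_zero fun h => by simp [h] at huv; omega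
  obtain ⟨c₁, hc₁⟩ : u ^ 3 ∣ c := by
    rw [← Nat.pow_dvd_pow_iff (n := 2) two_ne_zero]
    refine Dvd.dvd.trans ⟨v ^ 3, ?_⟩ hk3
    rw [← huv]; ring
  have hvc₁ : v ^ 3 ∣ c₁ ^ 2 := by
    refine Nat.dvd_of_mul_dvd_mul_left (pow_pos hu0 6) ?_
    have e : u ^ 6 * v ^ 3 = k ^ 3 := by rw [← huv]; ring
    have e' : u ^ 6 * c₁ ^ 2 = c ^ 2 := by rw [hc₁]; ring
    rwa [e, e']
  -- as `v` is squarefree, `v³ ∣ c₁²` forces `v² ∣ c₁`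
  obtain ⟨c₂, hc₂⟩ : v ∣ c₁ :=
    (hv.dvd_pow_iff_dvd two_ne_zero).1
      ((dvd_pow_self v three_ne_zero).trans hvc₁)
  obtain ⟨c₃, hc₃⟩ : v ∣ c₂ := by
    refine (hv.dvd_pow_iff_dvd two_ne_zero).1
      (Nat.dvd_of_mul_dvd_mul_left (pow_pos hv0 2) ?_)
    have e : v ^ 2 * v = v ^ 3 := by ring
    have e' : v ^ 2 * c₂ ^ 2 = c₁ ^ 2 := by rw [hc₂]; ring
    rwa [e, e']
  have e3 : a' * b' * (a' + b') = d' * v * c₃ ^ 2 := by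
    refine Nat.eq_of_mul_eq_mul_left (pow_pos hk0 3) ?_
    rw [e2, hc₁, hc₂, hc₃, ← huv]; ring
  obtain ⟨w, y, z, rfl, rfl, rfl, h1, h2, h3, h4⟩ :=
    exists_torsor_of_coprime ha0 hb0 (by omega) rfl hab e3
  refine ⟨s, u, w, y, z, ?_, ?_, ?_, ?_, hd', h4⟩
  · rw [← h1, ha', ← huv]; ring
  · rw [← h2, hb', ← huv]; ring
  · rw [← h3, ha', hb', ← huv]; ring
  · rw [hc₁, hc₂, hc₃]; ring

/-! ### The torsor equation as a linear equation -/

/-- Points of `[0, L]` at pairwise distance at least `δ` number at most `1 + L / δ`, because the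
integer parts of their multiples by `1 / δ` differ. -/
theorem card_le_of_separated {ι : Type*} (s : Finset ι) (f : ι → ℝ) {L δ : ℝ} (hL : 0 ≤ L)
    (hδ : 0 < δ) (h0 : ∀ i ∈ s, 0 ≤ f i) (h1 : ∀ i ∈ s, f i ≤ L)
    (hsep : ∀ i ∈ s, ∀ j ∈ s, i ≠ j → δ ≤ |f i - f j|) : (s.card : ℝ) ≤ 1 + L / δ := by
  have hcard : s.card ≤ (Finset.range (⌊L / δ⌋₊ + 1)).card := by
    refine Finset.card_le_card_of_injOn (fun i => ⌊f i / δ⌋₊) (fun i hi => ?_) ?_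
    · simp only [Finset.coe_range, Set.mem_Iio]
      exact Nat.lt_succ_of_le (Nat.floor_le_floor (by gcongr; exact h1 i hi))
    · intro i hi j hj hij
      by_contra hne
      have hs := hsep i hi j hj hne
      have a1 := Nat.floor_le (div_nonneg (h0 i hi) hδ.le)
      have a2 := Nat.lt_floor_add_one (f i / δ)
      have b1 := Nat.floor_le (div_nonneg (h0 j hj) hδ.le)
      have b2 := Nat.lt_floor_add_one (f j / δ)
      simp only at hij
      rw [hij] at a1 a2
      have : |f i / δ - f j / δ| < 1 := by rw [abs_lt]; constructor <;> linarith
      rw [← sub_div, abs_div, abs_of_pos hδ, div_lt_one hδ] at this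
      linarith
  rw [Finset.card_range] at hcard
  have h2 : ((⌊L / δ⌋₊ + 1 : ℕ) : ℝ) ≤ L / δ + 1 := by
    push_cast
    linarith [Nat.floor_le (div_nonneg hL hδ.le)]
  have h3 : (s.card : ℝ) ≤ ((⌊L / δ⌋₊ + 1 : ℕ) : ℝ) := by exact_mod_cast hcard
  linarith

/-- The dyadic interval `[2 ^ n, 2 ^ (n + 1))`. -/
def dyadic (n : ℕ) : Finset ℕ := Finset.Ico (2 ^ n) (2 ^ (n + 1))

theorem pos_of_mem_dyadic {n m : ℕ} (h : m ∈ dyadic n) : 0 < m :=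
  (Nat.two_pow_pos n).trans_le (Finset.mem_Ico.1 h).1

/-- The triples of positive integers whose components lie in prescribed dyadic intervals. -/
def dyadicBox (p : Fin 3 → ℕ) : Finset (Fin 3 → ℕ) := Fintype.piFinset fun j => dyadic (p j)

theorem mem_dyadicBox {p w : Fin 3 → ℕ} : w ∈ dyadicBox p ↔ ∀ j, w j ∈ dyadic (p j) :=
  Fintype.mem_piFinset

theorem card_dyadicBox (p : Fin 3 → ℕ) : (dyadicBox p).card = 2 ^ (p 0 + p 1 + p 2) := by
  have h : ∀ n, (dyadic n).card = 2 ^ n := fun n => by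
    rw [dyadic, Nat.card_Ico, pow_succ]; omega
  simp only [dyadicBox, Fintype.card_piFinset, h, Fin.prod_univ_three]
  rw [pow_add, pow_add]

open Classical in
/-- For fixed coefficients the torsor equation is linear in `z`: the fractions `z₀ / z₁` have
bounded denominators and agree modulo `w₂ y₂²`, so distinct ones are far apart. -/
theorem card_linear_le (w y r : Fin 3 → ℕ) :
    (((dyadicBox r).filter fun z => IsTorsorPoint w y z).card : ℝ) ≤
      1 + 8 * 2 ^ (r 0 + r 1) / (w 2 * y 2 ^ 2 : ℕ) := by
  rcases Nat.eq_zero_or_pos (w 2 * y 2 ^ 2) with hq | hq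
  · have : ((dyadicBox r).filter fun z => IsTorsorPoint w y z) = ∅ := by
      refine Finset.filter_eq_empty_iff.2 fun z _ hz => ?_
      have h1 := hz.1
      have h2 := hz.2.1
      rw [hq, zero_mul] at h1
      have h3 := Nat.add_eq_zero_iff.1 h1
      rw [h3.1, h3.2] at h2
      norm_num at h2
    rw [this, hq]
    simp
  set q := w 2 * y 2 ^ 2 with hqdef
  have hqr : (0 : ℝ) < q := by exact_mod_cast hq
  have hpow : ∀ n : ℕ, (0 : ℝ) < 2 ^ n := fun n => by positivity
  have key := card_le_of_separated ((dyadicBox r).filter fun z => IsTorsorPoint w y z)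
    (fun z => (z 0 : ℝ) / z 1) (L := 2 * 2 ^ r 0 / 2 ^ r 1) (δ := q / (4 * (2 ^ r 1) ^ 2))
    (by positivity) (by positivity) (fun z _ => by positivity) ?_ ?_
  · refine key.trans (le_of_eq ?_)
    rw [pow_add]
    field_simp
    ring
  · intro z hz
    have hz := mem_dyadicBox.1 (Finset.mem_filter.1 hz).1
    have h0 := (Finset.mem_Ico.1 (hz 0)).2
    have h1 := (Finset.mem_Ico.1 (hz 1)).1
    have h0' : (z 0 : ℝ) ≤ 2 * 2 ^ r 0 := by
      rw [pow_succ'] at h0; exact_mod_cast h0.le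
    have h1' : (2 : ℝ) ^ r 1 ≤ z 1 := by exact_mod_cast h1
    have := hpow (r 1)
    gcongr
  · intro z hz z' hz' hne
    obtain ⟨hz, e1, e2, e3, e4⟩ := Finset.mem_filter.1 hz
    obtain ⟨hz', f1, f2, f3, f4⟩ := Finset.mem_filter.1 hz'
    have hz := mem_dyadicBox.1 hz
    have hz' := mem_dyadicBox.1 hz'
    have p1 := pos_of_mem_dyadic (hz 1)
    have p1' := pos_of_mem_dyadic (hz' 1)
    -- the determinant of two solutions is divisible by the third coefficient
    have hdvd : (q : ℤ) ∣ (z 0 : ℤ) * z' 1 - z' 0 * z 1 := by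
      have hco : IsCoprime (q : ℤ) ((w 0 * y 0 ^ 2 : ℕ) : ℤ) := by
        rw [Nat.isCoprime_iff_coprime]
        exact ((e3.coprime_mul_right).coprime_mul_right_right).symm
      refine hco.dvd_of_dvd_mul_left ⟨z 2 * z' 1 - z' 2 * z 1, ?_⟩
      have e1' : ((w 0 * y 0 ^ 2 : ℕ) : ℤ) * z 0 + ((w 1 * y 1 ^ 2 : ℕ) : ℤ) * z 1 = q * z 2 := by
        exact_mod_cast e1
      have f1' : ((w 0 * y 0 ^ 2 : ℕ) : ℤ) * z' 0 + ((w 1 * y 1 ^ 2 : ℕ) : ℤ) * z' 1 =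
          q * z' 2 := by
        exact_mod_cast f1
      linear_combination (z' 1 : ℤ) * e1' - (z 1 : ℤ) * f1'
    -- distinct solutions have distinct ratios because `z₀` and `z₁` are coprime
    have hdet : (z 0 : ℤ) * z' 1 - z' 0 * z 1 ≠ 0 := by
      intro h
      have h' : z 0 * z' 1 = z' 0 * z 1 := by
        have := sub_eq_zero.1 h
        exact_mod_cast this
      have c : (z 0).Coprime (z 1) := e2.coprime_mul_left.coprime_mul_left_right
      have c' : (z' 0).Coprime (z' 1) := f2.coprime_mul_left.coprime_mul_left_right
      have g1 : z 1 = z' 1 := Nat.dvd_antisymm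
        (c.symm.dvd_of_dvd_mul_left ⟨z' 0, by rw [h']; ring⟩)
        (c'.symm.dvd_of_dvd_mul_left ⟨z 0, by rw [← h']; ring⟩)
      have g0 : z 0 = z' 0 := by
        rw [← g1] at h'
        exact Nat.eq_of_mul_eq_mul_right p1 h'
      have g2 : z 2 = z' 2 := by
        refine Nat.eq_of_mul_eq_mul_left hq ?_
        rw [hqdef, ← e1, ← f1, g0, g1]
      apply hne
      funext j
      fin_cases j
      · exact g0
      · exact g1
      · exact g2
    have habs : (q : ℤ) ≤ |(z 0 : ℤ) * z' 1 - z' 0 * z 1| :=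
      Int.le_of_dvd (abs_pos.2 hdet) ((dvd_abs _ _).2 hdvd)
    have habs' : (q : ℝ) ≤ |(z 0 : ℝ) * z' 1 - z' 0 * z 1| := by exact_mod_cast habs
    have p1r : (0 : ℝ) < z 1 := by exact_mod_cast p1
    have p1r' : (0 : ℝ) < z' 1 := by exact_mod_cast p1'
    have b1 : (z 1 : ℝ) ≤ 2 * 2 ^ r 1 := by
      have := (Finset.mem_Ico.1 (hz 1)).2
      rw [pow_succ'] at this; exact_mod_cast this.le
    have b1' : (z' 1 : ℝ) ≤ 2 * 2 ^ r 1 := by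
      have := (Finset.mem_Ico.1 (hz' 1)).2
      rw [pow_succ'] at this; exact_mod_cast this.le
    rw [div_sub_div _ _ p1r.ne' p1r'.ne', abs_div, abs_of_pos (mul_pos p1r p1r'),
      mul_comm (z 1 : ℝ) (z' 0 : ℝ)]
    calc (q : ℝ) / (4 * (2 ^ r 1) ^ 2) ≤ q / (z 1 * z' 1) := by
          refine div_le_div_of_nonneg_left hqr.le (mul_pos p1r p1r') ?_
          calc (z 1 : ℝ) * z' 1 ≤ (2 * 2 ^ r 1) * (2 * 2 ^ r 1) := by gcongr
            _ = _ := by ring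
      _ ≤ _ := by gcongr

/-! ### The torsor equation as a conic -/

/-- The triple `y` lies on the conic `b₀ y₀² + b₁ y₁² = b₂ y₂²`, and the products `bⱼ yⱼ` are
pairwise coprime; this is the torsor equation read with `bⱼ = wⱼ zⱼ` fixed. -/
def IsConicPoint (b y : Fin 3 → ℕ) : Prop :=
  b 0 * y 0 ^ 2 + b 1 * y 1 ^ 2 = b 2 * y 2 ^ 2 ∧
    ∀ i j, i ≠ j → Nat.Coprime (b i * y i) (b j * y j)

theorem IsTorsorPoint.isConicPoint {w y z : Fin 3 → ℕ} (h : IsTorsorPoint w y z) :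
    IsConicPoint (fun j => w j * z j) y := by
  obtain ⟨h1, h2, h3, h4⟩ := h
  have hd : ∀ j, w j * z j * y j ∣ w j * y j ^ 2 * z j := fun j => ⟨y j, by ring⟩
  have h5 := (h2.coprime_dvd_left (hd 0)).coprime_dvd_right (hd 1)
  have h6 := (h3.coprime_dvd_left (hd 0)).coprime_dvd_right (hd 2)
  have h7 := (h4.coprime_dvd_left (hd 1)).coprime_dvd_right (hd 2)
  refine ⟨by linear_combination h1, fun i j hij => ?_⟩
  fin_cases i <;> fin_cases j <;> first | exact absurd rfl hij | skip
  exacts [h5, h6, h5.symm, h7, h6.symm, h7.symm]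

/-- Let `(x₀, y₀)`, `(x, y)`, `(x', y')` have ratios that are, modulo `b`, square roots of one and
the same number. The gcd of `b` with `x y₀ - x₀ y` records at which primes the root of `(x, y)`
agrees with that of `(x₀, y₀)`; if it is the same for `(x, y)` and `(x', y')`, then the ratios of
these two agree modulo `b`, up to a factor `2`. -/
theorem dvd_two_mul_det {b x₀ y₀ x y x' y' : ℤ} (hb : b ≠ 0)
    (h : b ∣ (x * y₀) ^ 2 - (x₀ * y) ^ 2) (h' : b ∣ (x' * y₀) ^ 2 - (x₀ * y') ^ 2)
    (hx₀ : IsCoprime b x₀) (hy₀ : IsCoprime b y₀) (hx : IsCoprime b x)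
    (he : Int.gcd b (x * y₀ - x₀ * y) = Int.gcd b (x' * y₀ - x₀ * y')) :
    b ∣ 2 * (x * y' - x' * y) := by
  have hpos : 0 < Int.gcd b (x * y₀ - x₀ * y) := Int.gcd_pos_of_ne_zero_left _ hb
  have hpos' : 0 < Int.gcd b (x' * y₀ - x₀ * y') := he ▸ hpos
  obtain ⟨f, m, hfm, hf, hm⟩ := Int.exists_gcd_one hpos
  obtain ⟨f', m', hfm', hf', hm'⟩ := Int.exists_gcd_one hpos'
  rw [← he] at hf' hm'
  set e : ℤ := ((Int.gcd b (x * y₀ - x₀ * y) : ℕ) : ℤ) with hedef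
  have he0 : e ≠ 0 := by positivity
  have hff : f' = f := mul_right_cancel₀ he0 (hf'.symm.trans hf)
  rw [hff] at hf' hfm'
  have hfn : f ∣ x * y₀ + x₀ * y := by
    refine (Int.isCoprime_iff_gcd_eq_one.2 hfm).dvd_of_dvd_mul_left
      ((mul_dvd_mul_iff_left he0).1 ?_)
    have : e * (m * (x * y₀ + x₀ * y)) = (x * y₀) ^ 2 - (x₀ * y) ^ 2 := by
      linear_combination (-(x * y₀ + x₀ * y)) * hm
    rw [this, mul_comm, ← hf]
    exact h
  have hfn' : f ∣ x' * y₀ + x₀ * y' := by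
    refine (Int.isCoprime_iff_gcd_eq_one.2 hfm').dvd_of_dvd_mul_left
      ((mul_dvd_mul_iff_left he0).1 ?_)
    have : e * (m' * (x' * y₀ + x₀ * y')) = (x' * y₀) ^ 2 - (x₀ * y') ^ 2 := by
      linear_combination (-(x' * y₀ + x₀ * y')) * hm'
    rw [this, mul_comm, ← hf]
    exact h'
  have heb : e ∣ b := ⟨f, by rw [hf, mul_comm]⟩
  have hfb : f ∣ b := ⟨e, hf⟩
  have heD : e ∣ x * y' - x' * y := by
    refine (hx₀.of_isCoprime_of_dvd_left heb).dvd_of_dvd_mul_left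
      ⟨x' * m - x * m', ?_⟩
    linear_combination x' * hm - x * hm'
  have hfD : f ∣ x * y' - x' * y := by
    refine (hx₀.of_isCoprime_of_dvd_left hfb).dvd_of_dvd_mul_left ?_
    have := (hfn'.mul_left x).sub (hfn.mul_left x')
    convert this using 1
    ring
  -- the two complementary divisors share at most a factor `2`
  have hg : (Int.gcd e f : ℤ) ∣ 2 := by
    have h1 : (Int.gcd e f : ℤ) ∣ 2 * (x * y₀) := by
      have h2 : (Int.gcd e f : ℤ) ∣ x * y₀ - x₀ * y :=
        (Int.gcd_dvd_left e f).trans ⟨m, by rw [hm, mul_comm]⟩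
      have h3 : 2 * (x * y₀) = (x * y₀ - x₀ * y) + (x * y₀ + x₀ * y) := by ring
      rw [h3]
      exact dvd_add h2 ((Int.gcd_dvd_right e f).trans hfn)
    exact ((hx.mul_right hy₀).of_isCoprime_of_dvd_left
      ((Int.gcd_dvd_left e f).trans heb)).dvd_of_dvd_mul_right h1
  have hl : (Int.lcm e f : ℤ) ∣ x * y' - x' * y := Int.coe_lcm_dvd heD hfD
  have hgl : b ∣ (Int.gcd e f : ℤ) * Int.lcm e f := by
    have : ((Int.gcd e f * Int.lcm e f : ℕ) : ℤ) = |b| := by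
      rw [Int.gcd_mul_lcm, Int.abs_eq_natAbs, hf, mul_comm, Int.natAbs_mul]
    rw [← Nat.cast_mul, this]
    exact self_dvd_abs b
  exact hgl.trans (mul_dvd_mul hg hl)

/-- The real rational parameter `t` of a point of the conic: in the coordinates `√bⱼ yⱼ` the conic
becomes the circle of radius `√b₂ y₂`, and the point is proportional to
`((1 - t²) / 2, t, (1 + t²) / 2)`. -/
noncomputable def conicParam (b y : Fin 3 → ℕ) : ℝ :=
  √(b 1) * y 1 / (√(b 0) * y 0 + √(b 2) * y 2)

theorem conicParam_spec {b y : Fin 3 → ℕ} (h : IsConicPoint b y) (hb : ∀ j, 0 < b j)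
    (hy : ∀ j, 0 < y j) : 0 ≤ conicParam b y ∧ conicParam b y ≤ 1 ∧
      ∃ P : ℝ, 0 < P ∧ P ≤ 2 * (√(b 2) * y 2) ∧
        √(b 0) * y 0 = P * (1 - conicParam b y ^ 2) / 2 ∧
        √(b 1) * y 1 = P * conicParam b y ∧
        √(b 2) * y 2 = P * (1 + conicParam b y ^ 2) / 2 := by
  have hpos : ∀ j, 0 < √(b j : ℝ) * y j := fun j =>
    mul_pos (Real.sqrt_pos.2 (by exact_mod_cast hb j)) (by exact_mod_cast hy j)
  have hsq : (√(b 0 : ℝ) * y 0) ^ 2 + (√(b 1 : ℝ) * y 1) ^ 2 = (√(b 2 : ℝ) * y 2) ^ 2 := by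
    simp only [mul_pow, Real.sq_sqrt (Nat.cast_nonneg _)]
    exact_mod_cast h.1
  unfold conicParam
  have p0 := hpos 0
  have p1 := hpos 1
  have p2 := hpos 2
  generalize √(b 0 : ℝ) * y 0 = A at *
  generalize √(b 1 : ℝ) * y 1 = B at *
  generalize √(b 2 : ℝ) * y 2 = C at *
  have hAC : A ≤ C := by nlinarith
  have hBC : B ≤ C := by nlinarith
  have hP : 0 < A + C := by linarith
  refine ⟨by positivity, by rw [div_le_one hP]; linarith, A + C, hP, by linarith, ?_, ?_, ?_⟩
  · field_simp; linear_combination hsq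
  · field_simp
  · field_simp; linear_combination -hsq

theorem conicParam_injOn {b : Fin 3 → ℕ} (hb : ∀ j, 0 < b j) :
    Set.InjOn (conicParam b) {y | IsConicPoint b y ∧ ∀ j, 0 < y j} := by
  rintro y ⟨h, hy⟩ y' ⟨h', hy'⟩ ht
  obtain ⟨-, -, P, hP, -, e0, e1, e2⟩ := conicParam_spec h hb hy
  obtain ⟨-, -, P', hP', -, e0', e1', e2'⟩ := conicParam_spec h' hb hy'
  rw [← ht] at e0' e1' e2'
  have hs : ∀ j, √(b j : ℝ) ≠ 0 := fun j =>
    (Real.sqrt_pos.2 (by exact_mod_cast hb j)).ne'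
  have cross : (y 0 : ℝ) * y' 2 = y' 0 * y 2 := by
    refine mul_left_cancel₀ (mul_ne_zero (hs 0) (hs 2)) ?_
    calc √(b 0 : ℝ) * √(b 2 : ℝ) * (y 0 * y' 2)
        = (√(b 0 : ℝ) * y 0) * (√(b 2 : ℝ) * y' 2) := by ring
      _ = (√(b 0 : ℝ) * y' 0) * (√(b 2 : ℝ) * y 2) := by rw [e0, e2', e0', e2]; ring
      _ = _ := by ring
  have cross' : y 0 * y' 2 = y' 0 * y 2 := by exact_mod_cast cross
  have c : (y 0).Coprime (y 2) :=
    (h.2 0 2 (by decide)).coprime_mul_left.coprime_mul_left_right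
  have c' : (y' 0).Coprime (y' 2) :=
    (h'.2 0 2 (by decide)).coprime_mul_left.coprime_mul_left_right
  have g2 : y 2 = y' 2 := Nat.dvd_antisymm
    (c.symm.dvd_of_dvd_mul_left ⟨y' 0, by rw [cross']; ring⟩)
    (c'.symm.dvd_of_dvd_mul_left ⟨y 0, by rw [← cross']; ring⟩)
  have g0 : y 0 = y' 0 := by
    rw [← g2] at cross'
    exact Nat.eq_of_mul_eq_mul_right (hy 2) cross'
  have g1 : y 1 = y' 1 := by
    have h1 := h.1
    rw [g0, g2, ← h'.1] at h1
    have h2 := Nat.eq_of_mul_eq_mul_left (hb 1) (Nat.add_left_cancel h1)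
    exact Nat.pow_left_injective two_ne_zero h2
  funext j
  fin_cases j
  · exact g0
  · exact g1
  · exact g2

/-- The determinant of the matrix with rows `y`, `y'`, `y''`, expanded along its last column. -/
def det3 (y y' y'' : Fin 3 → ℕ) : ℤ :=
  (y 2 : ℤ) * (y' 0 * y'' 1 - y'' 0 * y' 1) - y' 2 * (y 0 * y'' 1 - y'' 0 * y 1) +
    y'' 2 * (y 0 * y' 1 - y' 0 * y 1)

/-- The determinant of three points of the conic is, in terms of their parameters, a Vandermonde
determinant. -/
theorem sqrt_mul_abs_det3 {b y y' y'' : Fin 3 → ℕ} (hb : ∀ j, 0 < b j)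
    (h : IsConicPoint b y) (hy : ∀ j, 0 < y j) (h' : IsConicPoint b y') (hy' : ∀ j, 0 < y' j)
    (h'' : IsConicPoint b y'') (hy'' : ∀ j, 0 < y'' j) :
    ∃ P P' P'' : ℝ, 0 < P ∧ P ≤ 2 * (√(b 2) * y 2) ∧ 0 < P' ∧ P' ≤ 2 * (√(b 2) * y' 2) ∧
      0 < P'' ∧ P'' ≤ 2 * (√(b 2) * y'' 2) ∧
      √(b 0) * √(b 1) * √(b 2) * |(det3 y y' y'' : ℝ)| = P * P' * P'' / 2 *
        (|conicParam b y - conicParam b y'| * |conicParam b y - conicParam b y''| *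
          |conicParam b y' - conicParam b y''|) := by
  obtain ⟨-, -, P, hP, hP2, e0, e1, e2⟩ := conicParam_spec h hb hy
  obtain ⟨-, -, P', hP', hP2', e0', e1', e2'⟩ := conicParam_spec h' hb hy'
  obtain ⟨-, -, P'', hP'', hP2'', e0'', e1'', e2''⟩ := conicParam_spec h'' hb hy''
  refine ⟨P, P', P'', hP, hP2, hP', hP2', hP'', hP2'', ?_⟩
  generalize conicParam b y = t at *
  generalize conicParam b y' = t' at *
  generalize conicParam b y'' = t'' at *
  have hpp : |P * P' * P'' / 2| = P * P' * P'' / 2 := abs_of_pos (by positivity)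
  have hss : |√(b 0 : ℝ) * √(b 1 : ℝ) * √(b 2 : ℝ)| = √(b 0 : ℝ) * √(b 1 : ℝ) * √(b 2 : ℝ) :=
    abs_of_nonneg (by positivity)
  rw [← hpp, ← abs_mul, ← abs_mul, ← abs_mul, ← hss, ← abs_mul, ← abs_neg]
  congr 1
  have : √(b 0 : ℝ) * √(b 1 : ℝ) * √(b 2 : ℝ) * (det3 y y' y'' : ℝ) =
      (√(b 2 : ℝ) * y 2) * ((√(b 0 : ℝ) * y' 0) * (√(b 1 : ℝ) * y'' 1) -
        (√(b 0 : ℝ) * y'' 0) * (√(b 1 : ℝ) * y' 1)) -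
      (√(b 2 : ℝ) * y' 2) * ((√(b 0 : ℝ) * y 0) * (√(b 1 : ℝ) * y'' 1) -
        (√(b 0 : ℝ) * y'' 0) * (√(b 1 : ℝ) * y 1)) +
      (√(b 2 : ℝ) * y'' 2) * ((√(b 0 : ℝ) * y 0) * (√(b 1 : ℝ) * y' 1) -
        (√(b 0 : ℝ) * y' 0) * (√(b 1 : ℝ) * y 1)) := by
    simp only [det3]
    push_cast
    ring
  rw [this, e0, e1, e2, e0', e1', e2', e0'', e1'', e2'']
  ring

/-- The congruence class of a conic point `y` relative to a base point `y₀`: for each coefficient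
`bⱼ`, its gcd with the minor of `y` and `y₀` in the other two columns. The number of classes is at
most the product of the numbers of divisors of the coefficients. -/
def conicClass (b y₀ y : Fin 3 → ℕ) : ℕ × ℕ × ℕ :=
  (Int.gcd (b 0) ((y 1 : ℤ) * y₀ 2 - y₀ 1 * y 2), Int.gcd (b 1) ((y 0 : ℤ) * y₀ 2 - y₀ 0 * y 2),
    Int.gcd (b 2) ((y 0 : ℤ) * y₀ 1 - y₀ 0 * y 1))

theorem dvd_two_mul_minors {b y₀ y y' : Fin 3 → ℕ} (hb : ∀ j, 0 < b j)
    (h₀ : IsConicPoint b y₀) (h : IsConicPoint b y) (h' : IsConicPoint b y')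
    (hc : conicClass b y₀ y = conicClass b y₀ y') :
    (b 0 : ℤ) ∣ 2 * ((y 1 : ℤ) * y' 2 - y' 1 * y 2) ∧
      (b 1 : ℤ) ∣ 2 * ((y 0 : ℤ) * y' 2 - y' 0 * y 2) ∧
      (b 2 : ℤ) ∣ 2 * ((y 0 : ℤ) * y' 1 - y' 0 * y 1) := by
  simp only [conicClass, Prod.mk.injEq] at hc
  have cop : ∀ {v : Fin 3 → ℕ}, IsConicPoint b v → ∀ i j, i ≠ j →
      IsCoprime (b i : ℤ) (v j : ℤ) := fun hv i j hij =>
    Nat.isCoprime_iff_coprime.2 (hv.2 i j hij).coprime_mul_right.coprime_mul_left_right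
  have copb : ∀ i j, i ≠ j → IsCoprime (b i : ℤ) (b j : ℤ) := fun i j hij =>
    Nat.isCoprime_iff_coprime.2 (h₀.2 i j hij).coprime_mul_right.coprime_mul_right_right
  have hbz : ∀ j, (b j : ℤ) ≠ 0 := fun j => by exact_mod_cast (hb j).ne'
  have heq : ∀ {v : Fin 3 → ℕ}, IsConicPoint b v →
      (b 0 : ℤ) * v 0 ^ 2 + b 1 * v 1 ^ 2 = b 2 * v 2 ^ 2 := fun hv => by exact_mod_cast hv.1
  have h₀e := heq h₀
  refine ⟨dvd_two_mul_det (hbz 0) ?_ ?_ (cop h₀ 0 1 (by decide)) (cop h₀ 0 2 (by decide))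
    (cop h 0 1 (by decide)) hc.1, dvd_two_mul_det (hbz 1) ?_ ?_ (cop h₀ 1 0 (by decide))
    (cop h₀ 1 2 (by decide)) (cop h 1 0 (by decide)) hc.2.1, dvd_two_mul_det (hbz 2) ?_ ?_
    (cop h₀ 2 0 (by decide)) (cop h₀ 2 1 (by decide)) (cop h 2 0 (by decide)) hc.2.2⟩
  · refine (copb 0 1 (by decide)).dvd_of_dvd_mul_left
      ⟨(y₀ 0 : ℤ) ^ 2 * y 2 ^ 2 - y 0 ^ 2 * y₀ 2 ^ 2, ?_⟩
    linear_combination (y₀ 2 : ℤ) ^ 2 * heq h - (y 2 : ℤ) ^ 2 * h₀e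
  · refine (copb 0 1 (by decide)).dvd_of_dvd_mul_left
      ⟨(y₀ 0 : ℤ) ^ 2 * y' 2 ^ 2 - y' 0 ^ 2 * y₀ 2 ^ 2, ?_⟩
    linear_combination (y₀ 2 : ℤ) ^ 2 * heq h' - (y' 2 : ℤ) ^ 2 * h₀e
  · refine (copb 1 0 (by decide)).dvd_of_dvd_mul_left
      ⟨(y₀ 1 : ℤ) ^ 2 * y 2 ^ 2 - y 1 ^ 2 * y₀ 2 ^ 2, ?_⟩
    linear_combination (y₀ 2 : ℤ) ^ 2 * heq h - (y 2 : ℤ) ^ 2 * h₀e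
  · refine (copb 1 0 (by decide)).dvd_of_dvd_mul_left
      ⟨(y₀ 1 : ℤ) ^ 2 * y' 2 ^ 2 - y' 1 ^ 2 * y₀ 2 ^ 2, ?_⟩
    linear_combination (y₀ 2 : ℤ) ^ 2 * heq h' - (y' 2 : ℤ) ^ 2 * h₀e
  · refine (copb 2 0 (by decide)).dvd_of_dvd_mul_left
      ⟨(y 2 : ℤ) ^ 2 * y₀ 1 ^ 2 - y₀ 2 ^ 2 * y 1 ^ 2, ?_⟩
    linear_combination (y₀ 1 : ℤ) ^ 2 * heq h - (y 1 : ℤ) ^ 2 * h₀e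
  · refine (copb 2 0 (by decide)).dvd_of_dvd_mul_left
      ⟨(y' 2 : ℤ) ^ 2 * y₀ 1 ^ 2 - y₀ 2 ^ 2 * y' 1 ^ 2, ?_⟩
    linear_combination (y₀ 1 : ℤ) ^ 2 * heq h' - (y' 1 : ℤ) ^ 2 * h₀e

theorem dvd_two_mul_det3 {b y₀ y y' y'' : Fin 3 → ℕ} (hb : ∀ j, 0 < b j)
    (h₀ : IsConicPoint b y₀) (h : IsConicPoint b y) (h' : IsConicPoint b y')
    (h'' : IsConicPoint b y'') (hc : conicClass b y₀ y = conicClass b y₀ y')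
    (hc' : conicClass b y₀ y = conicClass b y₀ y'') :
    (b 0 : ℤ) * b 1 * b 2 ∣ 2 * det3 y y' y'' := by
  have copb : ∀ i j, i ≠ j → IsCoprime (b i : ℤ) (b j : ℤ) := fun i j hij =>
    Nat.isCoprime_iff_coprime.2 (h₀.2 i j hij).coprime_mul_right.coprime_mul_right_right
  obtain ⟨a0, a1, a2⟩ := dvd_two_mul_minors hb h₀ h h' hc
  obtain ⟨b0, b1, b2⟩ := dvd_two_mul_minors hb h₀ h h'' hc'
  obtain ⟨c0, c1, c2⟩ := dvd_two_mul_minors hb h₀ h' h'' (hc.symm.trans hc')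
  refine IsCoprime.mul_dvd ((copb 0 2 (by decide)).mul_left (copb 1 2 (by decide)))
    (IsCoprime.mul_dvd (copb 0 1 (by decide)) ?_ ?_) ?_
  · convert ((c0.mul_left (y 0 : ℤ)).sub (b0.mul_left (y' 0 : ℤ))).add
      (a0.mul_left (y'' 0 : ℤ)) using 1
    simp only [det3]; ring
  · convert (((c1.mul_left (y 1 : ℤ)).sub (b1.mul_left (y' 1 : ℤ))).add
      (a1.mul_left (y'' 1 : ℤ))).neg_right using 1
    simp only [det3]; ring
  · convert ((c2.mul_left (y 2 : ℤ)).sub (b2.mul_left (y' 2 : ℤ))).add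
      (a2.mul_left (y'' 2 : ℤ)) using 1
    simp only [det3]; ring

/-- A bound for the number of coprime points on a conic. Among points of one class, three distinct
ones have a nonzero determinant divisible by `b₀ b₁ b₂` (up to a factor `2`), which forces the
parameters of two of them apart; so an interval of parameters of length `√(b₀ b₁) / (2 R)` holds
at most two. -/
theorem card_conic_le {b : Fin 3 → ℕ} (hb : ∀ j, 0 < b j) {R : ℝ} (hR : 0 < R)
    (s : Finset (Fin 3 → ℕ)) (hs : ∀ y ∈ s, IsConicPoint b y ∧ (∀ j, 0 < y j) ∧ (y 2 : ℝ) ≤ R) :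
    (s.card : ℝ) ≤ 2 * ((b 0).divisors.card * (b 1).divisors.card * (b 2).divisors.card) *
      (1 + 2 * R / √(b 0 * b 1)) := by
  classical
  rcases s.eq_empty_or_nonempty with rfl | ⟨y₀, hy₀⟩
  · simp only [Finset.card_empty, Nat.cast_zero]; positivity
  have h₀ := (hs y₀ hy₀).1
  have hbr : ∀ j, (0 : ℝ) < b j := fun j => by exact_mod_cast hb j
  set δ : ℝ := √(b 0 * b 1) / (2 * R) with hδdef
  have hδ : 0 < δ := by
    have := Real.sqrt_pos.2 (mul_pos (hbr 0) (hbr 1))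
    positivity
  let f : (Fin 3 → ℕ) → (ℕ × ℕ × ℕ) × ℕ := fun y => (conicClass b y₀ y, ⌊conicParam b y / δ⌋₊)
  have himg : s.image f ⊆ ((b 0).divisors ×ˢ (b 1).divisors ×ˢ (b 2).divisors) ×ˢ
      Finset.range (⌊1 / δ⌋₊ + 1) := by
    intro v hv
    obtain ⟨y, hy, rfl⟩ := Finset.mem_image.1 hv
    obtain ⟨h, hyp, -⟩ := hs y hy
    obtain ⟨t0, t1, -⟩ := conicParam_spec h hb hyp
    have hdiv : ∀ (j) (m : ℤ), Int.gcd (b j) m ∈ (b j).divisors := fun j m => by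
      refine Nat.mem_divisors.2 ⟨?_, (hb j).ne'⟩
      have := Int.gcd_dvd_left (b j : ℤ) m
      exact_mod_cast this
    simp only [f, conicClass, Finset.mem_product, Finset.mem_range]
    exact ⟨⟨hdiv _ _, hdiv _ _, hdiv _ _⟩,
      Nat.lt_succ_of_le (Nat.floor_le_floor (by gcongr))⟩
  -- a class and an interval of length `δ` for the parameter leave at most two points
  have hfib : ∀ a ∈ s.image f, (s.filter fun y => f y = a).card ≤ 2 := by
    intro a _
    by_contra! hcard
    obtain ⟨y, hy, y', hy', y'', hy'', n1, n2, n3⟩ := Finset.two_lt_card.1 hcard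
    obtain ⟨hy, hfy⟩ := Finset.mem_filter.1 hy
    obtain ⟨hy', hfy'⟩ := Finset.mem_filter.1 hy'
    obtain ⟨hy'', hfy''⟩ := Finset.mem_filter.1 hy''
    obtain ⟨h, hyp, hyR⟩ := hs y hy
    obtain ⟨h', hyp', hyR'⟩ := hs y' hy'
    obtain ⟨h'', hyp'', hyR''⟩ := hs y'' hy''
    have f1 : f y = f y' := hfy.trans hfy'.symm
    have f2 : f y = f y'' := hfy.trans hfy''.symm
    have hclose : ∀ v v', v ∈ s → v' ∈ s → f v = f v' →
        |conicParam b v - conicParam b v'| < δ := by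
      intro v v' hv hv' hvv
      obtain ⟨hc, hvp, -⟩ := hs v hv
      obtain ⟨hc', hvp', -⟩ := hs v' hv'
      have t := (conicParam_spec hc hb hvp).1
      have t' := (conicParam_spec hc' hb hvp').1
      have hfl : ⌊conicParam b v / δ⌋₊ = ⌊conicParam b v' / δ⌋₊ := congrArg Prod.snd hvv
      have a1 := Nat.floor_le (div_nonneg t hδ.le)
      have a2 := Nat.lt_floor_add_one (conicParam b v / δ)
      have b1 := Nat.floor_le (div_nonneg t' hδ.le)
      have b2 := Nat.lt_floor_add_one (conicParam b v' / δ)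
      rw [hfl] at a1 a2
      have : |conicParam b v / δ - conicParam b v' / δ| < 1 := by
        rw [abs_lt]; constructor <;> linarith
      rwa [← sub_div, abs_div, abs_of_pos hδ, div_lt_one hδ] at this
    have d1 := hclose y y' hy hy' f1
    have d2 := hclose y y'' hy hy'' f2
    have d3 := hclose y' y'' hy' hy'' (f1.symm.trans f2)
    have ne : ∀ v v', v ∈ s → v' ∈ s → v ≠ v' → 0 < |conicParam b v - conicParam b v'| :=
      fun v v' hv hv' hvv => abs_pos.2 (sub_ne_zero.2 fun he => hvv
        (conicParam_injOn hb ⟨(hs v hv).1, (hs v hv).2.1⟩ ⟨(hs v' hv').1, (hs v' hv').2.1⟩ he))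
    have m1 := ne y y' hy hy' n1
    have m2 := ne y y'' hy hy'' n2
    have m3 := ne y' y'' hy' hy'' n3
    obtain ⟨P, P', P'', hP, hP2, hP', hP2', hP'', hP2'', hdet⟩ :=
      sqrt_mul_abs_det3 hb h hyp h' hyp' h'' hyp''
    have s0 := Real.sqrt_pos.2 (hbr 0)
    have s1 := Real.sqrt_pos.2 (hbr 1)
    have s2 := Real.sqrt_pos.2 (hbr 2)
    have q0 := Real.sq_sqrt (hbr 0).le
    have q1 := Real.sq_sqrt (hbr 1).le
    have q2 := Real.sq_sqrt (hbr 2).le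
    have hδ' : δ = √(b 0 : ℝ) * √(b 1 : ℝ) / (2 * R) := by
      rw [hδdef, Real.sqrt_mul (hbr 0).le]
    have hdvd := dvd_two_mul_det3 hb h₀ h h' h'' (congrArg Prod.fst f1) (congrArg Prod.fst f2)
    have hdpos : 0 < |(det3 y y' y'' : ℝ)| := by
      have : 0 < √(b 0 : ℝ) * √(b 1 : ℝ) * √(b 2 : ℝ) * |(det3 y y' y'' : ℝ)| := by
        rw [hdet]; positivity
      exact pos_of_mul_pos_right this (by positivity)
    have hge : (b 0 : ℝ) * b 1 * b 2 ≤ 2 * |(det3 y y' y'' : ℝ)| := by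
      have hne : (2 * det3 y y' y'' : ℤ) ≠ 0 := by
        refine mul_ne_zero two_ne_zero fun h0 => ?_
        rw [h0] at hdpos
        simp at hdpos
      have := Int.le_of_dvd (abs_pos.2 hne) ((dvd_abs _ _).2 hdvd)
      rw [abs_mul, abs_two] at this
      exact_mod_cast this
    -- the three parameters lie in an interval too short for such a determinant
    have hlt : √(b 0 : ℝ) * √(b 1 : ℝ) * √(b 2 : ℝ) * |(det3 y y' y'' : ℝ)| <
        √(b 0 : ℝ) * √(b 1 : ℝ) * √(b 2 : ℝ) * ((b 0 : ℝ) * b 1 * b 2 / 2) := by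
      rw [hdet]
      have hPR : P ≤ 2 * (√(b 2 : ℝ) * R) := hP2.trans (by gcongr)
      have hPR' : P' ≤ 2 * (√(b 2 : ℝ) * R) := hP2'.trans (by gcongr)
      have hPR'' : P'' ≤ 2 * (√(b 2 : ℝ) * R) := hP2''.trans (by gcongr)
      calc P * P' * P'' / 2 * (|conicParam b y - conicParam b y'| *
            |conicParam b y - conicParam b y''| * |conicParam b y' - conicParam b y''|)
          < P * P' * P'' / 2 * (δ * δ * δ) := by gcongr
        _ ≤ (2 * (√(b 2 : ℝ) * R)) * (2 * (√(b 2 : ℝ) * R)) * (2 * (√(b 2 : ℝ) * R)) / 2 *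
            (δ * δ * δ) := by gcongr
        _ = √(b 0 : ℝ) * √(b 1 : ℝ) * √(b 2 : ℝ) *
            (√(b 0 : ℝ) ^ 2 * √(b 1 : ℝ) ^ 2 * √(b 2 : ℝ) ^ 2 / 2) := by
          rw [hδ']; field_simp
        _ = _ := by rw [q0, q1, q2]
    have := lt_of_mul_lt_mul_left hlt (by positivity)
    linarith
  have hcard := (Finset.card_le_mul_card_image s 2 hfib).trans
    (Nat.mul_le_mul_left 2 (Finset.card_le_card himg))
  rw [Finset.card_product, Finset.card_product, Finset.card_product, Finset.card_range] at hcard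
  have hcard' : (s.card : ℝ) ≤ 2 * (((b 0).divisors.card * ((b 1).divisors.card *
      (b 2).divisors.card)) * ((⌊1 / δ⌋₊ : ℝ) + 1)) := by exact_mod_cast hcard
  have hfloor : (⌊1 / δ⌋₊ : ℝ) ≤ 2 * R / √(b 0 * b 1) := by
    refine (Nat.floor_le (by positivity)).trans (le_of_eq ?_)
    rw [hδdef, one_div_div]
  calc (s.card : ℝ) ≤ _ := hcard'
    _ ≤ 2 * (((b 0).divisors.card * ((b 1).divisors.card * (b 2).divisors.card)) *
        (2 * R / √(b 0 * b 1) + 1)) := by gcongr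
    _ = _ := by ring

/-! ### Counting torsor points in dyadic boxes -/

theorem sum_card_divisors_dyadic_le (k : ℕ) :
    ∑ n ∈ dyadic k, (n.divisors.card : ℝ) ≤ 2 ^ (k + 1) * (k + 2) := by
  have h1 : ∑ n ∈ dyadic k, n.divisors.card ≤
      ∑ n ∈ Finset.Ioc 0 (2 ^ (k + 1)), (2 ^ (k + 1)) / n := by
    rw [← ArithmeticFunction.sum_Ioc_sigma0_eq_sum_div]
    simp only [ArithmeticFunction.sigma_zero_apply]
    refine Finset.sum_le_sum_of_subset fun n hn => ?_
    have := Finset.mem_Ico.1 hn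
    exact Finset.mem_Ioc.2 ⟨pos_of_mem_dyadic hn, this.2.le⟩
  have h2 : (∑ n ∈ Finset.Ioc 0 (2 ^ (k + 1)), (((2 ^ (k + 1)) / n : ℕ) : ℝ)) ≤
      2 ^ (k + 1) * (harmonic (2 ^ (k + 1)) : ℝ) := by
    rw [harmonic_eq_sum_Icc]
    push_cast
    rw [Finset.mul_sum]
    refine Finset.sum_le_sum fun n _ => ?_
    refine Nat.cast_div_le.trans (le_of_eq ?_)
    push_cast
    rw [div_eq_mul_inv]
  have h3 : (harmonic (2 ^ (k + 1)) : ℝ) ≤ k + 2 := by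
    refine (harmonic_le_one_add_log _).trans ?_
    push_cast
    rw [Real.log_pow]
    have : Real.log 2 ≤ 1 := Real.log_two_lt_d9.le.trans (by norm_num)
    push_cast
    nlinarith [(Nat.cast_nonneg k : (0 : ℝ) ≤ k)]
  calc ∑ n ∈ dyadic k, (n.divisors.card : ℝ) ≤
      ∑ n ∈ Finset.Ioc 0 (2 ^ (k + 1)), (((2 ^ (k + 1)) / n : ℕ) : ℝ) := by exact_mod_cast h1
    _ ≤ _ := h2
    _ ≤ _ := by gcongr

theorem card_divisors_mul_le (m n : ℕ) :
    (m * n).divisors.card ≤ m.divisors.card * n.divisors.card := by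
  classical
  rw [Nat.divisors_mul]
  exact Finset.card_mul_le

theorem sum_dyadicBox_card_divisors_le {p : Fin 3 → ℕ} {L : ℝ} (hp : ∀ j, (p j : ℝ) + 2 ≤ L) :
    ∑ w ∈ dyadicBox p, ∏ j, ((w j).divisors.card : ℝ) ≤
      8 * L ^ 3 * 2 ^ (p 0 + p 1 + p 2) := by
  rw [dyadicBox, ← Finset.prod_univ_sum (fun j => dyadic (p j)) fun _ n => (n.divisors.card : ℝ),
    Fin.prod_univ_three]
  have key : ∀ j, ∑ n ∈ dyadic (p j), (n.divisors.card : ℝ) ≤ 2 ^ (p j + 1) * L := fun j =>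
    (sum_card_divisors_dyadic_le _).trans (by have := hp j; gcongr)
  have hL : 0 ≤ L := le_trans (by positivity) (hp 0)
  have hn : ∀ j, 0 ≤ ∑ n ∈ dyadic (p j), (n.divisors.card : ℝ) := fun j => by positivity
  calc _ ≤ (2 ^ (p 0 + 1) * L) * (2 ^ (p 1 + 1) * L) * (2 ^ (p 2 + 1) * L) :=
        mul_le_mul (mul_le_mul (key 0) (key 1) (hn 1) (by positivity)) (key 2) (hn 2)
          (by positivity)
    _ = _ := by rw [pow_succ, pow_succ, pow_succ, pow_add, pow_add]; ring

open Classical in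
/-- The number of torsor points whose coordinates lie in prescribed dyadic intervals. -/
noncomputable def torsorCount (p q r : Fin 3 → ℕ) : ℕ :=
  ((dyadicBox p ×ˢ dyadicBox q ×ˢ dyadicBox r).filter
    fun t => IsTorsorPoint t.1 t.2.1 t.2.2).card

open Classical in
theorem torsorCount_eq_sum_linear (p q r : Fin 3 → ℕ) :
    torsorCount p q r = ∑ w ∈ dyadicBox p, ∑ y ∈ dyadicBox q,
      ((dyadicBox r).filter fun z => IsTorsorPoint w y z).card := by
  simp only [torsorCount, Finset.card_filter, Finset.sum_product]

open Classical in
theorem torsorCount_eq_sum_conic (p q r : Fin 3 → ℕ) :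
    torsorCount p q r = ∑ w ∈ dyadicBox p, ∑ z ∈ dyadicBox r,
      ((dyadicBox q).filter fun y => IsTorsorPoint w y z).card := by
  simp only [torsorCount, Finset.card_filter, Finset.sum_product]
  exact Finset.sum_congr rfl fun w _ => Finset.sum_comm

theorem two_pow_le_of_mem_dyadic {n m : ℕ} (h : m ∈ dyadic n) : (2 : ℝ) ^ n ≤ m := by
  exact_mod_cast (Finset.mem_Ico.1 h).1

theorem le_two_pow_of_mem_dyadic {n m : ℕ} (h : m ∈ dyadic n) : (m : ℝ) ≤ 2 ^ (n + 1) := by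
  exact_mod_cast (Finset.mem_Ico.1 h).2.le

theorem torsorCount_le_linear (p q r : Fin 3 → ℕ) :
    (torsorCount p q r : ℝ) ≤ 2 ^ (p 0 + p 1 + p 2 + (q 0 + q 1 + q 2)) *
      (1 + 8 * (2 ^ (r 0 + r 1) / 2 ^ (p 2 + 2 * q 2))) := by
  classical
  rw [torsorCount_eq_sum_linear]
  push_cast
  calc _ ≤ ∑ w ∈ dyadicBox p, ∑ y ∈ dyadicBox q,
        (1 + 8 * ((2 : ℝ) ^ (r 0 + r 1) / 2 ^ (p 2 + 2 * q 2))) := by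
        refine Finset.sum_le_sum fun w hw => Finset.sum_le_sum fun y hy => ?_
        refine (card_linear_le w y r).trans ?_
        have h1 := two_pow_le_of_mem_dyadic (mem_dyadicBox.1 hw 2)
        have h2 := two_pow_le_of_mem_dyadic (mem_dyadicBox.1 hy 2)
        rw [mul_div_assoc]
        gcongr
        push_cast
        rw [pow_add, pow_mul']
        gcongr
    _ = _ := by
        rw [Finset.sum_const, Finset.sum_const, card_dyadicBox, card_dyadicBox, nsmul_eq_mul,
          nsmul_eq_mul, ← mul_assoc, pow_add 2 (p 0 + p 1 + p 2)]
        push_cast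
        rfl

open Classical in
theorem card_conic_dyadicBox_le {p r w z : Fin 3 → ℕ} (q : Fin 3 → ℕ)
    (hw : ∀ j, w j ∈ dyadic (p j)) (hz : ∀ j, z j ∈ dyadic (r j)) :
    (((dyadicBox q).filter fun y => IsTorsorPoint w y z).card : ℝ) ≤
      2 * (1 + 4 * (2 ^ q 2 / √(2 ^ (p 0 + r 0 + (p 1 + r 1))))) *
        ((∏ j, ((w j).divisors.card : ℝ)) * ∏ j, ((z j).divisors.card : ℝ)) := by
  have h := card_conic_le (b := fun j => w j * z j) (R := 2 ^ (q 2 + 1))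
    (fun j => Nat.mul_pos (pos_of_mem_dyadic (hw j)) (pos_of_mem_dyadic (hz j)))
    (by positivity) ((dyadicBox q).filter fun y => IsTorsorPoint w y z) (fun y hy => by
      obtain ⟨hy, ht⟩ := Finset.mem_filter.1 hy
      have hy := mem_dyadicBox.1 hy
      exact ⟨ht.isConicPoint, fun j => pos_of_mem_dyadic (hy j),
        le_two_pow_of_mem_dyadic (hy 2)⟩)
  refine h.trans ?_
  have hd : ∀ j, ((w j * z j).divisors.card : ℝ) ≤
      (w j).divisors.card * (z j).divisors.card := fun j => by
    exact_mod_cast card_divisors_mul_le (w j) (z j)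
  have hsq : √((2 : ℝ) ^ (p 0 + r 0 + (p 1 + r 1))) ≤
      √(((w 0 * z 0 : ℕ) : ℝ) * ((w 1 * z 1 : ℕ) : ℝ)) := by
    have hw' := fun j => two_pow_le_of_mem_dyadic (hw j)
    have hz' := fun j => two_pow_le_of_mem_dyadic (hz j)
    push_cast
    rw [pow_add, pow_add, pow_add]
    refine Real.sqrt_le_sqrt ?_
    gcongr
    exacts [hw' 0, hz' 0, hw' 1, hz' 1]
  have hsq0 : 0 < √((2 : ℝ) ^ (p 0 + r 0 + (p 1 + r 1))) := by positivity
  have hKle : 1 + 2 * (2 : ℝ) ^ (q 2 + 1) / √(((w 0 * z 0 : ℕ) : ℝ) * ((w 1 * z 1 : ℕ) : ℝ)) ≤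
      1 + 4 * (2 ^ q 2 / √(2 ^ (p 0 + r 0 + (p 1 + r 1)))) := by
    have e : 2 * (2 : ℝ) ^ (q 2 + 1) = 4 * 2 ^ q 2 := by rw [pow_succ]; ring
    rw [e, mul_div_assoc]
    gcongr
  simp only [Fin.prod_univ_three]
  have hn : ∀ n : ℕ, (0 : ℝ) ≤ n.divisors.card := fun n => Nat.cast_nonneg _
  calc _ ≤ 2 * (((w 0).divisors.card * (z 0).divisors.card : ℝ) *
        ((w 1).divisors.card * (z 1).divisors.card) *
        ((w 2).divisors.card * (z 2).divisors.card)) *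
        (1 + 4 * (2 ^ q 2 / √(2 ^ (p 0 + r 0 + (p 1 + r 1))))) := by
        refine mul_le_mul (mul_le_mul_of_nonneg_left (mul_le_mul (mul_le_mul (hd 0) (hd 1)
          (hn _) (by positivity)) (hd 2) (hn _) (by positivity)) zero_le_two) hKle
          (by positivity) (by positivity)
    _ = _ := by ring

theorem torsorCount_le_conic {p q r : Fin 3 → ℕ} {L : ℝ} (hp : ∀ j, (p j : ℝ) + 2 ≤ L)
    (hr : ∀ j, (r j : ℝ) + 2 ≤ L) :
    (torsorCount p q r : ℝ) ≤ 128 * L ^ 6 * (2 ^ (p 0 + p 1 + p 2 + (r 0 + r 1 + r 2)) *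
      (1 + 4 * (2 ^ q 2 / √(2 ^ (p 0 + r 0 + (p 1 + r 1)))))) := by
  rw [torsorCount_eq_sum_conic]
  push_cast
  set K : ℝ := 1 + 4 * (2 ^ q 2 / √(2 ^ (p 0 + r 0 + (p 1 + r 1)))) with hK
  have hK0 : 0 ≤ K := by positivity
  have hL : 0 ≤ L := le_trans (by positivity) (hp 0)
  calc _ ≤ ∑ w ∈ dyadicBox p, ∑ z ∈ dyadicBox r,
        2 * K * ((∏ j, ((w j).divisors.card : ℝ)) * ∏ j, ((z j).divisors.card : ℝ)) :=
        Finset.sum_le_sum fun w hw => Finset.sum_le_sum fun z hz =>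
          card_conic_dyadicBox_le q (mem_dyadicBox.1 hw) (mem_dyadicBox.1 hz)
    _ = 2 * K * ((∑ w ∈ dyadicBox p, ∏ j, ((w j).divisors.card : ℝ)) *
        ∑ z ∈ dyadicBox r, ∏ j, ((z j).divisors.card : ℝ)) := by
        rw [Finset.sum_mul_sum, Finset.mul_sum]
        exact Finset.sum_congr rfl fun w _ => by rw [Finset.mul_sum]
    _ ≤ 2 * K * ((8 * L ^ 3 * 2 ^ (p 0 + p 1 + p 2)) * (8 * L ^ 3 * 2 ^ (r 0 + r 1 + r 2))) := by
        refine mul_le_mul_of_nonneg_left (mul_le_mul (sum_dyadicBox_card_divisors_le hp)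
          (sum_dyadicBox_card_divisors_le hr) ?_ (by positivity)) (by positivity)
        exact Finset.sum_nonneg fun z _ => Finset.prod_nonneg fun j _ => Nat.cast_nonneg _
    _ = _ := by rw [pow_add 2 (p 0 + p 1 + p 2)]; ring

/-! ### Summation over dyadic boxes -/

/-- The sum of a function over a finite set that is parametrised by `a` integers from `[0, M]` and
`b` natural numbers, with geometric decay in the latter: each of the former costs a factor
`M + 1`, each of the latter only a constant. -/
theorem sum_le_of_geometric {ι : Type*} (K : Finset ι) (F : ι → ℝ) {a b M : ℕ} {κ : ℝ}
    (φ : ι → Fin a → ℕ) (ψ : ι → Fin b → ℕ)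
    (hinj : Set.InjOn (fun k => (φ k, ψ k)) K) (hφ : ∀ k ∈ K, ∀ j, φ k j ≤ M)
    (hF : ∀ k ∈ K, F k ≤ (2 : ℝ) ^ (κ - (∑ j, ψ k j : ℕ) / 5)) :
    ∑ k ∈ K, F k ≤ (2 : ℝ) ^ κ * (M + 1) ^ a * (1 / (1 - (2 : ℝ) ^ (-1 / 5 : ℝ))) ^ b := by
  classical
  set ρ : ℝ := (2 : ℝ) ^ (-1 / 5 : ℝ) with hρ
  have hρ0 : 0 < ρ := by positivity
  have hρ1 : ρ < 1 := Real.rpow_lt_one_of_one_lt_of_neg one_lt_two (by norm_num)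
  set T := K.sup (fun k => ∑ j, ψ k j) + 1
  let G : (Fin a → ℕ) × (Fin b → ℕ) → ℝ := fun t => (2 : ℝ) ^ κ * ∏ j, ρ ^ t.2 j
  have hG : ∀ k ∈ K, F k ≤ G (φ k, ψ k) := by
    intro k hk
    refine (hF k hk).trans (le_of_eq ?_)
    simp only [G]
    rw [Finset.prod_pow_eq_pow_sum, hρ, ← Real.rpow_mul_natCast zero_le_two,
      ← Real.rpow_add two_pos]
    congr 1
    ring
  have hsub : K.image (fun k => (φ k, ψ k)) ⊆
      (Fintype.piFinset fun _ : Fin a => Finset.range (M + 1)) ×ˢ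
        (Fintype.piFinset fun _ : Fin b => Finset.range T) := by
    intro t ht
    obtain ⟨k, hk, rfl⟩ := Finset.mem_image.1 ht
    simp only [Finset.mem_product, Fintype.mem_piFinset, Finset.mem_range]
    refine ⟨fun j => Nat.lt_succ_of_le (hφ k hk j), fun j => Nat.lt_succ_of_le ?_⟩
    exact (Finset.single_le_sum (f := fun j => ψ k j) (fun _ _ => Nat.zero_le _)
      (Finset.mem_univ j)).trans (Finset.le_sup (f := fun k => ∑ j, ψ k j) hk)
  have hgeo : ∑ n ∈ Finset.range T, ρ ^ n ≤ 1 / (1 - ρ) := by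
    rw [geom_sum_eq hρ1.ne, ← neg_div_neg_eq]
    have : 0 < 1 - ρ := by linarith
    rw [neg_sub, neg_sub]
    gcongr
    linarith [pow_pos hρ0 T]
  calc ∑ k ∈ K, F k ≤ ∑ k ∈ K, G (φ k, ψ k) := Finset.sum_le_sum hG
    _ = ∑ t ∈ K.image (fun k => (φ k, ψ k)), G t := (Finset.sum_image hinj).symm
    _ ≤ ∑ t ∈ (Fintype.piFinset fun _ : Fin a => Finset.range (M + 1)) ×ˢ
        (Fintype.piFinset fun _ : Fin b => Finset.range T), G t :=
        Finset.sum_le_sum_of_subset_of_nonneg hsub fun t _ _ => by positivity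
    _ = (2 : ℝ) ^ κ * (M + 1) ^ a * (∑ n ∈ Finset.range T, ρ ^ n) ^ b := by
        simp only [G, Finset.sum_product, ← Finset.mul_sum]
        rw [← Finset.prod_univ_sum (fun _ => Finset.range T) fun (_ : Fin b) n => ρ ^ n]
        simp only [Finset.prod_const, Finset.card_univ, Fintype.card_fin, Finset.sum_const,
          Fintype.card_piFinset, Finset.card_range, nsmul_eq_mul]
        push_cast
        ring
    _ ≤ _ := by gcongr

/-- The exponents `(i, p, q, r)` of a dyadic box: `u ~ 2 ^ i`, `wⱼ ~ 2 ^ pⱼ`, `yⱼ ~ 2 ^ qⱼ`,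
`zⱼ ~ 2 ^ rⱼ`. -/
abbrev Exponents : Type := ℕ × (Fin 3 → ℕ) × (Fin 3 → ℕ) × (Fin 3 → ℕ)

namespace Exponents

/-- The exponent of the `j`-th term `wⱼ yⱼ² zⱼ` of the torsor equation. -/
def term (j : Fin 3) : Exponents → ℕ := fun (_, p, q, r) => p j + 2 * q j + r j

/-- The exponent of `u³ (w₀ w₁ w₂)² y₀ y₁ y₂`. -/
def sizeC : Exponents → ℕ := fun (i, p, q, _) =>
  3 * i + 2 * (p 0 + p 1 + p 2) + (q 0 + q 1 + q 2)

/-- The exponent of `z₀ z₁ z₂`. -/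
def sizeD : Exponents → ℕ := fun (_, _, _, r) => r 0 + r 1 + r 2

/-- The exponent of `u² (w₀ w₁ w₂) (w₂ y₂² z₂)`. -/
def sizeA : Exponents → ℕ := fun (i, p, q, r) =>
  2 * i + (p 0 + p 1 + p 2) + (p 2 + 2 * q 2 + r 2)

/-- The conditions that size bounds and the torsor equation impose on the exponents of a box. The
last term of the equation is the largest, and `a` is the index of another term that is comparable
to it. -/
structure IsAdmissible (M D A : ℕ) (a : Fin 3) (k : Exponents) : Prop where
  sizeC_le : sizeC k ≤ M
  sizeD_le : sizeD k ≤ D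
  sizeA_le : sizeA k ≤ A
  term_zero_le : term 0 k ≤ term 2 k + 3
  term_one_le : term 1 k ≤ term 2 k + 3
  term_two_le : term 2 k ≤ term a k + 4

/-- The exponent of the number of `(u, w, y)` in a box. -/
noncomputable def boxUWY : Exponents → ℝ := fun (i, p, q, _) =>
  (i : ℝ) + (p 0 + p 1 + p 2) + (q 0 + q 1 + q 2)

/-- The exponent of the number of `(u, w, z)` in a box. -/
noncomputable def boxUWZ : Exponents → ℝ := fun (i, p, _, r) =>
  (i : ℝ) + (p 0 + p 1 + p 2) + (r 0 + r 1 + r 2)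

/-- The exponent of the main term of the bound that treats the equation as linear in `z`. -/
noncomputable def linearMain : Exponents → ℝ := fun (i, p, q, r) =>
  (i : ℝ) + (p 0 + p 1 + p 2) + (q 0 + q 1 + q 2) + (r 0 + r 1) - (p 2 + 2 * q 2)

/-- The exponent of the main term of the bound that treats the equation as a conic in `y`, without
the factor from divisor functions. -/
noncomputable def conicMain : Exponents → ℝ := fun (i, p, q, r) =>
  (i : ℝ) + (p 0 + p 1 + p 2) + (r 0 + r 1 + r 2) + q 2 - (p 0 + r 0 + (p 1 + r 1)) / 2

theorem ext_of_apply {i i' : ℕ} {p q r p' q' r' : Fin 3 → ℕ} (hi : i = i')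
    (h : p 0 = p' 0 ∧ p 1 = p' 1 ∧ p 2 = p' 2 ∧ q 0 = q' 0 ∧ q 1 = q' 1 ∧ q 2 = q' 2 ∧
      r 0 = r' 0 ∧ r 1 = r' 1 ∧ r 2 = r' 2) :
    ((i, p, q, r) : Exponents) = (i', p', q', r') := by
  have ext3 : ∀ {v v' : Fin 3 → ℕ}, v 0 = v' 0 → v 1 = v' 1 → v 2 = v' 2 → v = v' := by
    intro v v' h0 h1 h2
    funext j
    fin_cases j
    exacts [h0, h1, h2]
  obtain ⟨h0, h1, h2, h3, h4, h5, h6, h7, h8⟩ := h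
  rw [hi, ext3 h0 h1 h2, ext3 h3 h4 h5, ext3 h6 h7 h8]

end Exponents

open Exponents

theorem le_max_of_le_add {F a b c d : ℝ} (h1 : F ≤ a + b) (h2 : F ≤ c + d)
    (ha : 0 ≤ a) (hb : 0 ≤ b) (hc : 0 ≤ c) (hd : 0 ≤ d) : F ≤ b + min a c + min a d := by
  rcases le_total a c with h | h <;> rcases le_total a d with h' | h'
  all_goals simp only [min_eq_left, min_eq_right, h, h']
  all_goals linarith

theorem min_rpow_le {x y θ : ℝ} (h0 : 0 ≤ θ) (h1 : θ ≤ 1) :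
    min ((2 : ℝ) ^ x) ((2 : ℝ) ^ y) ≤ (2 : ℝ) ^ ((1 - θ) * x + θ * y) := by
  rcases le_total x y with h | h
  · exact (min_le_left _ _).trans (Real.rpow_le_rpow_of_exponent_le one_le_two (by nlinarith))
  · exact (min_le_right _ _).trans (Real.rpow_le_rpow_of_exponent_le one_le_two (by nlinarith))

/-- The two bounds for the number of points in a box combined: outside the main term of the linear
bound, the minimum of the two is replaced by weighted geometric means. The weights are such that
the logarithms of the conic bound enter only to the powers `12 / 5` and `4`, while enough decay in
all sizes remains. -/
theorem torsorCount_le_rpow {k : Exponents} {l : ℝ}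
    (hp : ∀ j, (k.2.1 j : ℝ) + 2 ≤ 2 ^ l) (hr : ∀ j, (k.2.2.2 j : ℝ) + 2 ≤ 2 ^ l) :
    ((2 ^ k.1 * torsorCount k.2.1 k.2.2.1 k.2.2.2 : ℕ) : ℝ) ≤
      (2 : ℝ) ^ (3 + linearMain k) +
      (2 : ℝ) ^ ((1 - 2 / 5) * boxUWY k + 2 / 5 * (7 + 6 * l + boxUWZ k)) +
      (2 : ℝ) ^ ((1 - 2 / 3) * boxUWY k + 2 / 3 * (9 + 6 * l + conicMain k)) := by
  obtain ⟨i, p, q, r⟩ := k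
  simp only [linearMain, boxUWY, boxUWZ, conicMain] at *
  have hn : ∀ n : ℕ, (2 : ℝ) ^ n = (2 : ℝ) ^ (n : ℝ) := fun n => (Real.rpow_natCast 2 n).symm
  have h1 : ((2 ^ i * torsorCount p q r : ℕ) : ℝ) ≤
      (2 : ℝ) ^ ((i : ℝ) + (p 0 + p 1 + p 2) + (q 0 + q 1 + q 2)) +
      (2 : ℝ) ^ (3 + ((i : ℝ) + (p 0 + p 1 + p 2) + (q 0 + q 1 + q 2) + (r 0 + r 1) -
        (p 2 + 2 * q 2))) := by
    push_cast
    refine (mul_le_mul_of_nonneg_left (torsorCount_le_linear p q r) (by positivity)).trans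
      (le_of_eq ?_)
    have h8 : (8 : ℝ) = (2 : ℝ) ^ (3 : ℝ) := by norm_num
    rw [h8, mul_add, mul_add, mul_one]
    simp only [hn, ← Real.rpow_add two_pos, ← Real.rpow_sub two_pos]
    push_cast
    congr 2 <;> ring
  have h2 : ((2 ^ i * torsorCount p q r : ℕ) : ℝ) ≤
      (2 : ℝ) ^ (7 + 6 * l + ((i : ℝ) + (p 0 + p 1 + p 2) + (r 0 + r 1 + r 2))) +
      (2 : ℝ) ^ (9 + 6 * l + ((i : ℝ) + (p 0 + p 1 + p 2) + (r 0 + r 1 + r 2) + q 2 -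
          (p 0 + r 0 + (p 1 + r 1)) / 2)) := by
    push_cast
    refine (mul_le_mul_of_nonneg_left (torsorCount_le_conic hp hr) (by positivity)).trans
      (le_of_eq ?_)
    have h128 : (128 : ℝ) = (2 : ℝ) ^ (7 : ℝ) := by norm_num
    have h4 : (4 : ℝ) = (2 : ℝ) ^ (2 : ℝ) := by norm_num
    have h6 : ((2 : ℝ) ^ l) ^ 6 = (2 : ℝ) ^ (6 * l) := by
      rw [← Real.rpow_mul_natCast zero_le_two]; push_cast; congr 1; ring
    rw [h128, h4, h6, mul_add, mul_add, mul_add, mul_one, Real.sqrt_eq_rpow]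
    simp only [hn, ← Real.rpow_add two_pos, ← Real.rpow_sub two_pos, ← Real.rpow_mul zero_le_two]
    push_cast
    congr 2 <;> ring
  refine (le_max_of_le_add h1 h2 (by positivity) (by positivity) (by positivity)
    (by positivity)).trans ?_
  gcongr
  · exact min_rpow_le (by norm_num) (by norm_num)
  · exact min_rpow_le (by norm_num) (by norm_num)

/-- Six exponents are free up to `M`; the four slacks in the conditions on the box give geometric
decay. The terms `a`, `2` of the equation being comparable, the slack of the term `b` measures how
far the largest term exceeds the geometric mean of all three. -/
theorem sum_linearMain_le {M D A : ℕ} {ν σ : ℝ} {a b : Fin 3}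
    {K : Finset Exponents} (hM : (M : ℝ) ≤ ν) (hD : (D : ℝ) ≤ ν - 3 * σ)
    (hσ : 0 ≤ σ) (hab : a = 0 ∧ b = 1 ∨ a = 1 ∧ b = 0)
    (hK : ∀ k ∈ K, IsAdmissible M D A a k) :
    ∑ k ∈ K, (2 : ℝ) ^ (3 + linearMain k) ≤
      (2 : ℝ) ^ (9 + (ν - 6 / 5 * σ)) * (M + 1) ^ 6 *
        (1 / (1 - (2 : ℝ) ^ (-1 / 5 : ℝ))) ^ 4 := by
  refine sum_le_of_geometric K _
    (fun k => ![k.1, k.2.1 0, k.2.1 1, k.2.1 2, k.2.2.1 0, k.2.2.1 1])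
    (fun k => ![M - sizeC k, D - sizeD k, term 2 k + 3 - term b k,
      term a k + 4 - term 2 k]) ?_ ?_ ?_
  -- no subtraction truncates, so the exponents are recovered by linear algebra
  · rintro ⟨i, p, q, r⟩ hk ⟨i', p', q', r'⟩ hk' h
    obtain ⟨c1, c2, c3, c4, c5, c6⟩ := hK _ hk
    obtain ⟨d1, d2, d3, d4, d5, d6⟩ := hK _ hk'
    simp only [Prod.mk.injEq, Matrix.vecCons_inj, and_true] at h
    simp only [sizeC, sizeD, sizeA, term] at h c1 c2 c3 c4 c5 c6 d1 d2 d3 d4 d5 d6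
    refine ext_of_apply ?_ ⟨?_, ?_, ?_, ?_, ?_, ?_, ?_, ?_, ?_⟩ <;>
      rcases hab with ⟨rfl, rfl⟩ | ⟨rfl, rfl⟩ <;> omega
  · rintro ⟨i, p, q, r⟩ hk j
    obtain ⟨c1, c2, c3, c4, c5, c6⟩ := hK _ hk
    simp only [sizeC, sizeA] at c1 c3
    fin_cases j <;> simp <;> omega
  -- after passage to exponents the estimate is linear in them
  · rintro ⟨i, p, q, r⟩ hk
    obtain ⟨c1, c2, c3, c4, c5, c6⟩ := hK _ hk
    refine Real.rpow_le_rpow_of_exponent_le one_le_two ?_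
    simp only [Fin.sum_univ_four, Matrix.cons_val]
    have n0 := fun j => (Nat.cast_nonneg (p j) : (0 : ℝ) ≤ p j)
    have n1 := n0 1
    have n2 := n0 2
    have n0 := n0 0
    have ni := (Nat.cast_nonneg i : (0 : ℝ) ≤ i)
    have r1 := (Nat.cast_le (α := ℝ)).2 c1
    have r2 := (Nat.cast_le (α := ℝ)).2 c2
    have r3 := (Nat.cast_le (α := ℝ)).2 c3
    have r4 := (Nat.cast_le (α := ℝ)).2 c4
    have r5 := (Nat.cast_le (α := ℝ)).2 c5
    have r6 := (Nat.cast_le (α := ℝ)).2 c6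
    rcases hab with ⟨rfl, rfl⟩ | ⟨rfl, rfl⟩
    all_goals
      push_cast [Nat.cast_sub c1, Nat.cast_sub c2, Nat.cast_sub c3, Nat.cast_sub c4,
        Nat.cast_sub c5, Nat.cast_sub c6]
      simp only [sizeC, sizeD, sizeA, term, linearMain] at *
      push_cast at *
      linarith

/-- Here `2 ^ l` stands for the size of the logarithm. The exponents of `u` and `w` decay, so only
two exponents of `y` and the slack in `sizeA` are free. -/
theorem sum_boxUWY_boxUWZ_le {M D A : ℕ} {ν σ l : ℝ} {a b : Fin 3}
    {K : Finset Exponents} (hM : (M : ℝ) ≤ ν) (hD : (D : ℝ) ≤ ν - 3 * σ)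
    (hAM : A ≤ M) (hab : a = 0 ∧ b = 1 ∨ a = 1 ∧ b = 0)
    (hK : ∀ k ∈ K, IsAdmissible M D A a k) :
    ∑ k ∈ K, (2 : ℝ) ^ ((1 - 2 / 5) * boxUWY k + 2 / 5 * (7 + 6 * l + boxUWZ k)) ≤
      (2 : ℝ) ^ (9 + 12 / 5 * l + (ν - 6 / 5 * σ)) * (M + 1) ^ 3 *
        (1 / (1 - (2 : ℝ) ^ (-1 / 5 : ℝ))) ^ 7 := by
  refine sum_le_of_geometric K _
    (fun k => ![k.2.2.1 0, k.2.2.1 1, A - sizeA k])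
    (fun k => ![k.1, k.2.1 0, k.2.1 1, k.2.1 2, M - sizeC k, D - sizeD k,
      term a k + 4 - term 2 k]) ?_ ?_ ?_
  -- no subtraction truncates, so the exponents are recovered by linear algebra
  · rintro ⟨i, p, q, r⟩ hk ⟨i', p', q', r'⟩ hk' h
    obtain ⟨c1, c2, c3, c4, c5, c6⟩ := hK _ hk
    obtain ⟨d1, d2, d3, d4, d5, d6⟩ := hK _ hk'
    simp only [Prod.mk.injEq, Matrix.vecCons_inj, and_true] at h
    simp only [sizeC, sizeD, sizeA, term] at h c1 c2 c3 c4 c5 c6 d1 d2 d3 d4 d5 d6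
    refine ext_of_apply ?_ ⟨?_, ?_, ?_, ?_, ?_, ?_, ?_, ?_, ?_⟩ <;>
      rcases hab with ⟨rfl, rfl⟩ | ⟨rfl, rfl⟩ <;> omega
  · rintro ⟨i, p, q, r⟩ hk j
    obtain ⟨c1, c2, c3, c4, c5, c6⟩ := hK _ hk
    simp only [sizeC, sizeA] at c1 c3
    fin_cases j <;> simp <;> omega
  -- after passage to exponents the estimate is linear in them
  · rintro ⟨i, p, q, r⟩ hk
    obtain ⟨c1, c2, c3, c4, c5, c6⟩ := hK _ hk
    refine Real.rpow_le_rpow_of_exponent_le one_le_two ?_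
    simp only [Fin.sum_univ_seven, Matrix.cons_val]
    have n0 := fun j => (Nat.cast_nonneg (p j) : (0 : ℝ) ≤ p j)
    have n1 := n0 1
    have n2 := n0 2
    have n0 := n0 0
    have ni := (Nat.cast_nonneg i : (0 : ℝ) ≤ i)
    have r1 := (Nat.cast_le (α := ℝ)).2 c1
    have r2 := (Nat.cast_le (α := ℝ)).2 c2
    have r3 := (Nat.cast_le (α := ℝ)).2 c3
    have r4 := (Nat.cast_le (α := ℝ)).2 c4
    have r5 := (Nat.cast_le (α := ℝ)).2 c5
    have r6 := (Nat.cast_le (α := ℝ)).2 c6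
    rcases hab with ⟨rfl, rfl⟩ | ⟨rfl, rfl⟩
    all_goals
      push_cast [Nat.cast_sub c1, Nat.cast_sub c2, Nat.cast_sub c3, Nat.cast_sub c4,
        Nat.cast_sub c5, Nat.cast_sub c6]
      simp only [sizeC, sizeD, sizeA, term, boxUWY, boxUWZ] at *
      push_cast at *
      linarith

/-- Here the exponents of `u` and `w` and the slacks in all three size conditions decay, so only
two exponents of `y` are free. -/
theorem sum_boxUWY_conicMain_le {M D A : ℕ} {ν σ l : ℝ} {a b : Fin 3}
    {K : Finset Exponents} (hM : (M : ℝ) ≤ ν) (hD : (D : ℝ) ≤ ν - 3 * σ)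
    (hA : (A : ℝ) ≤ ν - σ) (hσ : 0 ≤ σ) (hab : a = 0 ∧ b = 1 ∨ a = 1 ∧ b = 0)
    (hK : ∀ k ∈ K, IsAdmissible M D A a k) :
    ∑ k ∈ K, (2 : ℝ) ^ ((1 - 2 / 3) * boxUWY k + 2 / 3 * (9 + 6 * l + conicMain k)) ≤
      (2 : ℝ) ^ (9 + 4 * l + (ν - 6 / 5 * σ)) * (M + 1) ^ 2 *
        (1 / (1 - (2 : ℝ) ^ (-1 / 5 : ℝ))) ^ 8 := by
  refine sum_le_of_geometric K _
    (fun k => ![k.2.2.1 0, k.2.2.1 1])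
    (fun k => ![k.1, k.2.1 0, k.2.1 1, k.2.1 2, M - sizeC k, D - sizeD k,
      A - sizeA k, term a k + 4 - term 2 k]) ?_ ?_ ?_
  -- no subtraction truncates, so the exponents are recovered by linear algebra
  · rintro ⟨i, p, q, r⟩ hk ⟨i', p', q', r'⟩ hk' h
    obtain ⟨c1, c2, c3, c4, c5, c6⟩ := hK _ hk
    obtain ⟨d1, d2, d3, d4, d5, d6⟩ := hK _ hk'
    simp only [Prod.mk.injEq, Matrix.vecCons_inj, and_true] at h
    simp only [sizeC, sizeD, sizeA, term] at h c1 c2 c3 c4 c5 c6 d1 d2 d3 d4 d5 d6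
    refine ext_of_apply ?_ ⟨?_, ?_, ?_, ?_, ?_, ?_, ?_, ?_, ?_⟩ <;>
      rcases hab with ⟨rfl, rfl⟩ | ⟨rfl, rfl⟩ <;> omega
  · rintro ⟨i, p, q, r⟩ hk j
    obtain ⟨c1, c2, c3, c4, c5, c6⟩ := hK _ hk
    simp only [sizeC, sizeA] at c1 c3
    fin_cases j <;> simp <;> omega
  -- after passage to exponents the estimate is linear in them
  · rintro ⟨i, p, q, r⟩ hk
    obtain ⟨c1, c2, c3, c4, c5, c6⟩ := hK _ hk
    refine Real.rpow_le_rpow_of_exponent_le one_le_two ?_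
    simp only [Fin.sum_univ_eight, Matrix.cons_val]
    have n0 := fun j => (Nat.cast_nonneg (p j) : (0 : ℝ) ≤ p j)
    have n1 := n0 1
    have n2 := n0 2
    have n0 := n0 0
    have ni := (Nat.cast_nonneg i : (0 : ℝ) ≤ i)
    have r1 := (Nat.cast_le (α := ℝ)).2 c1
    have r2 := (Nat.cast_le (α := ℝ)).2 c2
    have r3 := (Nat.cast_le (α := ℝ)).2 c3
    have r4 := (Nat.cast_le (α := ℝ)).2 c4
    have r5 := (Nat.cast_le (α := ℝ)).2 c5
    have r6 := (Nat.cast_le (α := ℝ)).2 c6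
    rcases hab with ⟨rfl, rfl⟩ | ⟨rfl, rfl⟩
    all_goals
      push_cast [Nat.cast_sub c1, Nat.cast_sub c2, Nat.cast_sub c3, Nat.cast_sub c4,
        Nat.cast_sub c5, Nat.cast_sub c6]
      simp only [sizeC, sizeD, sizeA, term, boxUWY, conicMain] at *
      push_cast at *
      linarith

/-- The sum over all admissible boxes. With `2 ^ ν = N` and `2 ^ σ = s`, the parameters `M`, `D`,
`A` correspond to the bounds `N`, `N / s ^ 3`, `N / s` for the three sizes. -/
theorem exists_sum_torsorCount_le : ∃ C : ℝ, 0 < C ∧ ∀ (M D A : ℕ) (ν σ : ℝ) (a b : Fin 3)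
    (K : Finset Exponents), (M : ℝ) ≤ ν → (D : ℝ) ≤ ν - 3 * σ → (A : ℝ) ≤ ν - σ → D ≤ M →
    A ≤ M → 0 ≤ σ → (a = 0 ∧ b = 1 ∨ a = 1 ∧ b = 0) → (∀ k ∈ K, IsAdmissible M D A a k) →
    ∑ k ∈ K, ((2 ^ k.1 * torsorCount k.2.1 k.2.2.1 k.2.2.2 : ℕ) : ℝ) ≤
      C * (2 : ℝ) ^ (ν - 6 / 5 * σ) * (M + 2) ^ 6 := by
  set c := 1 / (1 - (2 : ℝ) ^ (-1 / 5 : ℝ)) with hc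
  have hc0 : 0 < c := by
    have : (2 : ℝ) ^ (-1 / 5 : ℝ) < 1 :=
      Real.rpow_lt_one_of_one_lt_of_neg one_lt_two (by norm_num)
    have : 0 < 1 - (2 : ℝ) ^ (-1 / 5 : ℝ) := by linarith
    positivity
  refine ⟨2 ^ (9 : ℝ) * (c ^ 4 + c ^ 7 + c ^ 8), by positivity, ?_⟩
  intro M D A ν σ a b K hM hD hA hDM hAM hσ hab hK
  obtain ⟨l, hl⟩ : ∃ l : ℝ, (2 : ℝ) ^ l = M + 2 :=
    ⟨Real.logb 2 (M + 2), Real.rpow_logb two_pos (by norm_num) (by positivity)⟩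
  have hl0 : 0 ≤ l := by
    by_contra! h
    have := Real.rpow_lt_one_of_one_lt_of_neg one_lt_two h
    rw [hl] at this
    linarith [(Nat.cast_nonneg M : (0 : ℝ) ≤ M)]
  have B₁ := sum_linearMain_le hM hD hσ hab hK
  have B₂ := sum_boxUWY_boxUWZ_le (l := l) hM hD hAM hab hK
  have B₃ := sum_boxUWY_conicMain_le (l := l) hM hD hA hσ hab hK
  rw [← hc] at B₁ B₂ B₃
  have hM0 : (0 : ℝ) ≤ M := Nat.cast_nonneg M
  have hsplit : ∀ x : ℝ, (2 : ℝ) ^ (9 + x + (ν - 6 / 5 * σ)) =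
      2 ^ (9 : ℝ) * 2 ^ (ν - 6 / 5 * σ) * 2 ^ x := fun x => by
    rw [Real.rpow_add two_pos, Real.rpow_add two_pos]; ring
  have E₁ : (2 : ℝ) ^ (9 + (ν - 6 / 5 * σ)) * (M + 1) ^ 6 ≤
      2 ^ (9 : ℝ) * 2 ^ (ν - 6 / 5 * σ) * (M + 2) ^ 6 := by
    rw [Real.rpow_add two_pos]
    gcongr
    norm_num
  have E₂ : (2 : ℝ) ^ (9 + 12 / 5 * l + (ν - 6 / 5 * σ)) * (M + 1) ^ 3 ≤
      2 ^ (9 : ℝ) * 2 ^ (ν - 6 / 5 * σ) * (M + 2) ^ 6 := by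
    have h3 : (2 : ℝ) ^ (12 / 5 * l) ≤ (M + 2) ^ 3 := by
      rw [← hl, ← Real.rpow_mul_natCast zero_le_two]
      refine Real.rpow_le_rpow_of_exponent_le one_le_two ?_
      push_cast
      linarith
    rw [hsplit, mul_assoc]
    gcongr
    calc (2 : ℝ) ^ (12 / 5 * l) * (M + 1) ^ 3 ≤ (M + 2) ^ 3 * (M + 2) ^ 3 := by
          gcongr
          norm_num
      _ = _ := by ring
  have E₃ : (2 : ℝ) ^ (9 + 4 * l + (ν - 6 / 5 * σ)) * (M + 1) ^ 2 ≤
      2 ^ (9 : ℝ) * 2 ^ (ν - 6 / 5 * σ) * (M + 2) ^ 6 := by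
    have h4 : (2 : ℝ) ^ (4 * l) = (M + 2) ^ 4 := by
      rw [← hl, ← Real.rpow_mul_natCast zero_le_two]
      congr 1
      push_cast
      ring
    rw [hsplit, mul_assoc, h4]
    gcongr
    calc ((M : ℝ) + 2) ^ 4 * (M + 1) ^ 2 ≤ (M + 2) ^ 4 * (M + 2) ^ 2 := by
          gcongr
          norm_num
      _ = _ := by ring
  calc _ ≤ ∑ k ∈ K, ((2 : ℝ) ^ (3 + linearMain k) +
        (2 : ℝ) ^ ((1 - 2 / 5) * boxUWY k + 2 / 5 * (7 + 6 * l + boxUWZ k)) +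
        (2 : ℝ) ^ ((1 - 2 / 3) * boxUWY k + 2 / 3 * (9 + 6 * l + conicMain k))) := by
        refine Finset.sum_le_sum fun k hk => ?_
        obtain ⟨i, p, q, r⟩ := k
        obtain ⟨c1, c2, -, -, -, -⟩ := hK _ hk
        simp only [sizeC, sizeD] at c1 c2
        refine torsorCount_le_rpow (fun j => ?_) fun j => ?_
        · have : p j ≤ M := by fin_cases j <;> simp <;> omega
          rw [hl]
          gcongr
        · have : r j ≤ M := by fin_cases j <;> simp <;> omega
          rw [hl]
          gcongr
    _ = _ := by rw [Finset.sum_add_distrib, Finset.sum_add_distrib]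
    _ ≤ 2 ^ (9 : ℝ) * 2 ^ (ν - 6 / 5 * σ) * (M + 2) ^ 6 * c ^ 4 +
        2 ^ (9 : ℝ) * 2 ^ (ν - 6 / 5 * σ) * (M + 2) ^ 6 * c ^ 7 +
        2 ^ (9 : ℝ) * 2 ^ (ν - 6 / 5 * σ) * (M + 2) ^ 6 * c ^ 8 := by
        refine add_le_add (add_le_add (B₁.trans ?_) (B₂.trans ?_)) (B₃.trans ?_)
        · exact mul_le_mul_of_nonneg_right E₁ (by positivity)
        · exact mul_le_mul_of_nonneg_right E₂ (by positivity)
        · exact mul_le_mul_of_nonneg_right E₃ (by positivity)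
    _ = _ := by ring

/-! ### Counting all torsor points -/

/-- The torsor points `(u, w, y, z)` that, together with the scaling factor `s`, make `a + b`, `c`
and `d` at most `N`. -/
def torsorFiber (N s : ℕ) : Set (ℕ × (Fin 3 → ℕ) × (Fin 3 → ℕ) × (Fin 3 → ℕ)) :=
  {t | 0 < t.1 ∧ (∀ j, 0 < t.2.1 j) ∧ (∀ j, 0 < t.2.2.1 j) ∧ (∀ j, 0 < t.2.2.2 j) ∧
    IsTorsorPoint t.2.1 t.2.2.1 t.2.2.2 ∧
    t.1 ^ 3 * (t.2.1 0 * t.2.1 1 * t.2.1 2) ^ 2 * (t.2.2.1 0 * t.2.2.1 1 * t.2.2.1 2) ≤ N ∧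
    s ^ 3 * (t.2.2.2 0 * t.2.2.2 1 * t.2.2.2 2) ≤ N ∧
    s * t.1 ^ 2 * (t.2.1 0 * t.2.1 1 * t.2.1 2) * (t.2.1 2 * t.2.2.1 2 ^ 2 * t.2.2.2 2) ≤ N}

theorem mem_dyadic_log {n : ℕ} (hn : 0 < n) : n ∈ dyadic (Nat.log 2 n) :=
  Finset.mem_Ico.2 ⟨Nat.pow_log_le_self 2 hn.ne', Nat.lt_pow_succ_log_self one_lt_two n⟩

/-- The exponents of the dyadic box that contains `(u, w, y, z)`. -/
def exponentsOf (t : ℕ × (Fin 3 → ℕ) × (Fin 3 → ℕ) × (Fin 3 → ℕ)) : Exponents :=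
  (Nat.log 2 t.1, fun j => Nat.log 2 (t.2.1 j), fun j => Nat.log 2 (t.2.2.1 j),
    fun j => Nat.log 2 (t.2.2.2 j))

theorem two_pow_term_le {t : ℕ × (Fin 3 → ℕ) × (Fin 3 → ℕ) × (Fin 3 → ℕ)}
    (hw : ∀ j, 0 < t.2.1 j) (hy : ∀ j, 0 < t.2.2.1 j) (hz : ∀ j, 0 < t.2.2.2 j) (j : Fin 3) :
    2 ^ term j (exponentsOf t) ≤ t.2.1 j * t.2.2.1 j ^ 2 * t.2.2.2 j ∧
      t.2.1 j * t.2.2.1 j ^ 2 * t.2.2.2 j < 2 ^ (term j (exponentsOf t) + 4) := by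
  have a := Nat.pow_log_le_self 2 (hw j).ne'
  have b := Nat.pow_log_le_self 2 (hy j).ne'
  have c := Nat.pow_log_le_self 2 (hz j).ne'
  have a' := Nat.lt_pow_succ_log_self one_lt_two (t.2.1 j)
  have b' := Nat.lt_pow_succ_log_self one_lt_two (t.2.2.1 j)
  have c' := Nat.lt_pow_succ_log_self one_lt_two (t.2.2.2 j)
  simp only [term, exponentsOf]
  constructor
  · rw [pow_add, pow_add, pow_mul']
    gcongr
  · calc _ < 2 ^ (Nat.log 2 (t.2.1 j) + 1) * (2 ^ (Nat.log 2 (t.2.2.1 j) + 1)) ^ 2 *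
          2 ^ (Nat.log 2 (t.2.2.2 j) + 1) := by gcongr
      _ = _ := by rw [← pow_mul, ← pow_add, ← pow_add]; congr 1; ring

theorem isAdmissible_exponentsOf {N s : ℕ} (hs : 0 < s)
    {t : ℕ × (Fin 3 → ℕ) × (Fin 3 → ℕ) × (Fin 3 → ℕ)} (ht : t ∈ torsorFiber N s) :
    IsAdmissible (Nat.log 2 N) (Nat.log 2 (N / s ^ 3)) (Nat.log 2 (N / s)) 0 (exponentsOf t) ∨
      IsAdmissible (Nat.log 2 N) (Nat.log 2 (N / s ^ 3)) (Nat.log 2 (N / s)) 1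
        (exponentsOf t) := by
  obtain ⟨hu, hw, hy, hz, hT, hC, hD, hA⟩ := ht
  have lu := Nat.pow_log_le_self 2 hu.ne'
  have lw := fun j => Nat.pow_log_le_self 2 (hw j).ne'
  have ly := fun j => Nat.pow_log_le_self 2 (hy j).ne'
  have lz := fun j => Nat.pow_log_le_self 2 (hz j).ne'
  have lW := Nat.mul_le_mul (Nat.mul_le_mul (lw 0) (lw 1)) (lw 2)
  have lY := Nat.mul_le_mul (Nat.mul_le_mul (ly 0) (ly 1)) (ly 2)
  have lZ := Nat.mul_le_mul (Nat.mul_le_mul (lz 0) (lz 1)) (lz 2)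
  have ht := two_pow_term_le hw hy hz
  have h1 : sizeC (exponentsOf t) ≤ Nat.log 2 N := by
    refine Nat.le_log_of_pow_le one_lt_two (le_trans ?_ hC)
    calc 2 ^ sizeC (exponentsOf t) = (2 ^ Nat.log 2 t.1) ^ 3 *
          (2 ^ Nat.log 2 (t.2.1 0) * 2 ^ Nat.log 2 (t.2.1 1) * 2 ^ Nat.log 2 (t.2.1 2)) ^ 2 *
          (2 ^ Nat.log 2 (t.2.2.1 0) * 2 ^ Nat.log 2 (t.2.2.1 1) *
            2 ^ Nat.log 2 (t.2.2.1 2)) := by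
          simp only [sizeC, exponentsOf, ← pow_add, ← pow_mul]
          congr 1
          ring
      _ ≤ _ := by gcongr
  have h2 : sizeD (exponentsOf t) ≤ Nat.log 2 (N / s ^ 3) := by
    refine Nat.le_log_of_pow_le one_lt_two ((Nat.le_div_iff_mul_le (pow_pos hs 3)).2 ?_)
    rw [mul_comm]
    refine le_trans (Nat.mul_le_mul_left _ ?_) hD
    calc 2 ^ sizeD (exponentsOf t) = 2 ^ Nat.log 2 (t.2.2.2 0) * 2 ^ Nat.log 2 (t.2.2.2 1) *
            2 ^ Nat.log 2 (t.2.2.2 2) := by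
          simp only [sizeD, exponentsOf, ← pow_add]
      _ ≤ _ := lZ
  have h3 : sizeA (exponentsOf t) ≤ Nat.log 2 (N / s) := by
    refine Nat.le_log_of_pow_le one_lt_two ((Nat.le_div_iff_mul_le hs).2 ?_)
    rw [mul_comm]
    refine le_trans ?_ hA
    rw [mul_assoc, mul_assoc]
    refine Nat.mul_le_mul_left _ ?_
    calc 2 ^ sizeA (exponentsOf t) = (2 ^ Nat.log 2 t.1) ^ 2 *
          ((2 ^ Nat.log 2 (t.2.1 0) * 2 ^ Nat.log 2 (t.2.1 1) * 2 ^ Nat.log 2 (t.2.1 2)) *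
          2 ^ term 2 (exponentsOf t)) := by
          simp only [sizeA, term, exponentsOf, ← pow_add, ← pow_mul]
          congr 1
          ring
      _ ≤ _ := by
        have := (ht 2).1
        gcongr
  have hpow : ∀ {m n : ℕ}, 2 ^ m < 2 ^ n → m < n := fun h =>
    (Nat.pow_lt_pow_iff_right one_lt_two).1 h
  have h4 : term 0 (exponentsOf t) ≤ term 2 (exponentsOf t) + 3 :=
    Nat.le_of_lt_succ (hpow ((ht 0).1.trans_lt (lt_of_le_of_lt (by have := hT.1; omega) (ht 2).2)))
  have h5 : term 1 (exponentsOf t) ≤ term 2 (exponentsOf t) + 3 :=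
    Nat.le_of_lt_succ (hpow ((ht 1).1.trans_lt (lt_of_le_of_lt (by have := hT.1; omega) (ht 2).2)))
  have h6 : ∀ j, t.2.1 2 * t.2.2.1 2 ^ 2 * t.2.2.2 2 ≤
      2 * (t.2.1 j * t.2.2.1 j ^ 2 * t.2.2.2 j) →
      term 2 (exponentsOf t) ≤ term j (exponentsOf t) + 4 := fun j hj => by
    have := (ht 2).1
    have := (ht j).2
    refine Nat.le_of_lt_succ (hpow ?_)
    rw [Nat.succ_eq_add_one, pow_succ]
    omega
  have hsum := hT.1
  -- the larger of the first two terms is at least half of the third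
  rcases le_total (t.2.1 1 * t.2.2.1 1 ^ 2 * t.2.2.2 1) (t.2.1 0 * t.2.2.1 0 ^ 2 * t.2.2.2 0)
    with h | h
  · exact Or.inl ⟨h1, h2, h3, h4, h5, h6 0 (by omega)⟩
  · exact Or.inr ⟨h1, h2, h3, h4, h5, h6 1 (by omega)⟩

theorem torsorFiber_finite (N s : ℕ) (hs : 0 < s) : (torsorFiber N s).Finite := by
  classical
  have hfin : ((Finset.range (N + 1) ×ˢ
      (Fintype.piFinset fun _ : Fin 3 => Finset.range (N + 1)) ×ˢ
      (Fintype.piFinset fun _ : Fin 3 => Finset.range (N + 1)) ×ˢ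
      (Fintype.piFinset fun _ : Fin 3 => Finset.range (N + 1)) :
      Finset (ℕ × (Fin 3 → ℕ) × (Fin 3 → ℕ) × (Fin 3 → ℕ))) :
      Set (ℕ × (Fin 3 → ℕ) × (Fin 3 → ℕ) × (Fin 3 → ℕ))).Finite := Finset.finite_toSet _
  refine hfin.subset ?_
  rintro ⟨u, w, y, z⟩ ⟨hu, hw, hy, hz, -, hC, hD, -⟩
  simp only at hu hw hy hz hC hD
  have w0 := hw 0
  have w1 := hw 1
  have w2 := hw 2
  have y0 := hy 0
  have y1 := hy 1
  have y2 := hy 2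
  have z0 := hz 0
  have z1 := hz 1
  have z2 := hz 2
  have hCpos : 0 < u ^ 3 * (w 0 * w 1 * w 2) ^ 2 * (y 0 * y 1 * y 2) := by positivity
  have hDpos : 0 < s ^ 3 * (z 0 * z 1 * z 2) := by positivity
  have hdC : ∀ m, m ∣ u ^ 3 * (w 0 * w 1 * w 2) ^ 2 * (y 0 * y 1 * y 2) → m < N + 1 :=
    fun m hm => Nat.lt_succ_of_le ((Nat.le_of_dvd hCpos hm).trans hC)
  have hdD : ∀ m, m ∣ s ^ 3 * (z 0 * z 1 * z 2) → m < N + 1 :=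
    fun m hm => Nat.lt_succ_of_le ((Nat.le_of_dvd hDpos hm).trans hD)
  simp only [Finset.mem_coe, Finset.mem_product, Fintype.mem_piFinset, Finset.mem_range]
  refine ⟨hdC _ ⟨u ^ 2 * (w 0 * w 1 * w 2) ^ 2 * (y 0 * y 1 * y 2), by ring⟩, fun j => hdC _ ?_,
    fun j => hdC _ ?_, fun j => hdD _ ?_⟩ <;> fin_cases j
  · exact ⟨u ^ 3 * (w 0 * (w 1 * w 2) ^ 2) * (y 0 * y 1 * y 2), by simp; ring⟩
  · exact ⟨u ^ 3 * (w 1 * (w 0 * w 2) ^ 2) * (y 0 * y 1 * y 2), by simp; ring⟩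
  · exact ⟨u ^ 3 * (w 2 * (w 0 * w 1) ^ 2) * (y 0 * y 1 * y 2), by simp; ring⟩
  · exact ⟨u ^ 3 * (w 0 * w 1 * w 2) ^ 2 * (y 1 * y 2), by simp; ring⟩
  · exact ⟨u ^ 3 * (w 0 * w 1 * w 2) ^ 2 * (y 0 * y 2), by simp; ring⟩
  · exact ⟨u ^ 3 * (w 0 * w 1 * w 2) ^ 2 * (y 0 * y 1), by simp; ring⟩
  · exact ⟨s ^ 3 * (z 1 * z 2), by simp; ring⟩
  · exact ⟨s ^ 3 * (z 0 * z 2), by simp; ring⟩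
  · exact ⟨s ^ 3 * (z 0 * z 1), by simp; ring⟩

open Classical in
theorem card_le_sum_torsorCount (S : Finset (ℕ × (Fin 3 → ℕ) × (Fin 3 → ℕ) × (Fin 3 → ℕ)))
    {N s : ℕ} (hS : ∀ t ∈ S, t ∈ torsorFiber N s) :
    S.card ≤ ∑ k ∈ S.image exponentsOf, 2 ^ k.1 * torsorCount k.2.1 k.2.2.1 k.2.2.2 := by
  have hsub : S ⊆ (S.image exponentsOf).biUnion fun k => dyadic k.1 ×ˢ
      ((dyadicBox k.2.1 ×ˢ dyadicBox k.2.2.1 ×ˢ dyadicBox k.2.2.2).filter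
        fun t => IsTorsorPoint t.1 t.2.1 t.2.2) := by
    intro t ht
    obtain ⟨hu, hw, hy, hz, hT, -⟩ := hS t ht
    refine Finset.mem_biUnion.2 ⟨exponentsOf t, Finset.mem_image_of_mem _ ht, ?_⟩
    simp only [Finset.mem_product, Finset.mem_filter, mem_dyadicBox, exponentsOf]
    exact ⟨mem_dyadic_log hu, ⟨fun j => mem_dyadic_log (hw j), fun j => mem_dyadic_log (hy j),
      fun j => mem_dyadic_log (hz j)⟩, hT⟩
  refine (Finset.card_le_card hsub).trans (Finset.card_biUnion_le.trans (le_of_eq ?_))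
  refine Finset.sum_congr rfl fun k _ => ?_
  rw [Finset.card_product, torsorCount, dyadic, Nat.card_Ico, pow_succ]
  congr 1
  omega

theorem natLog_le_logb_sub {N s e : ℕ} (hs : 0 < s) (hN : s ^ e ≤ N) :
    (Nat.log 2 (N / s ^ e) : ℝ) ≤ Real.logb 2 N - e * Real.logb 2 s := by
  have hpos : 0 < N / s ^ e := Nat.div_pos hN (pow_pos hs e)
  have h1 := Nat.pow_log_le_self 2 hpos.ne'
  have h2 : s ^ e * 2 ^ Nat.log 2 (N / s ^ e) ≤ N :=
    (Nat.mul_le_mul_left _ h1).trans (Nat.mul_div_le N (s ^ e))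
  have h3 : ((s : ℝ) ^ e * 2 ^ Nat.log 2 (N / s ^ e)) ≤ N := by exact_mod_cast h2
  have hs' : (0 : ℝ) < s := by exact_mod_cast hs
  have h4 := Real.logb_le_logb_of_le one_lt_two (by positivity) h3
  rw [Real.logb_mul (by positivity) (by positivity), Real.logb_pow, Real.logb_pow,
    Real.logb_self_eq_one one_lt_two] at h4
  linarith

/-- The power of `s` is below `-1`, so the sum over all scaling factors converges. -/
theorem exists_ncard_torsorFiber_le : ∃ C : ℝ, 0 < C ∧ ∀ N s : ℕ, 0 < s →
    ((torsorFiber N s).ncard : ℝ) ≤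
      C * N * (s : ℝ) ^ (-6 / 5 : ℝ) * (Nat.log 2 N + 2) ^ 6 := by
  classical
  obtain ⟨C, hC, h⟩ := exists_sum_torsorCount_le
  refine ⟨2 * C, by positivity, fun N s hs => ?_⟩
  have hs' : (0 : ℝ) < s := by exact_mod_cast hs
  -- for larger `s` there are no points, as `s ^ 3` divides the fourth coordinate
  by_cases hN : s ^ 3 ≤ N
  swap
  · have : torsorFiber N s = ∅ := by
      refine Set.eq_empty_of_forall_notMem ?_
      rintro ⟨u, w, y, z⟩ ⟨-, -, -, hz, -, -, hD, -⟩
      simp only at hz hD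
      have : 0 < z 0 * z 1 * z 2 := Nat.mul_pos (Nat.mul_pos (hz 0) (hz 1)) (hz 2)
      exact hN ((Nat.le_mul_of_pos_right _ this).trans hD)
    rw [this, Set.ncard_empty, Nat.cast_zero]
    positivity
  have hsN : s ^ 1 ≤ N := (Nat.pow_le_pow_right hs (by norm_num)).trans hN
  have hN0 : 0 < N := (pow_pos hs 3).trans_le hN
  have hN' : (0 : ℝ) < N := by exact_mod_cast hN0
  set M := Nat.log 2 N
  have e0 := natLog_le_logb_sub (e := 0) hs ((pow_zero s).trans_le hN0)
  have e1 := natLog_le_logb_sub hs hsN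
  have e3 := natLog_le_logb_sub hs hN
  rw [pow_zero, Nat.div_one] at e0
  rw [pow_one] at e1
  push_cast at e0 e1 e3
  rw [zero_mul, sub_zero] at e0
  rw [one_mul] at e1
  have hσ : 0 ≤ Real.logb 2 (s : ℝ) := Real.logb_nonneg one_lt_two (by exact_mod_cast hs)
  have hfin := torsorFiber_finite N s hs
  set S := hfin.toFinset
  have hmem : ∀ t ∈ S, t ∈ torsorFiber N s := fun t ht => hfin.mem_toFinset.1 ht
  have key : ∀ a b : Fin 3, (a = 0 ∧ b = 1 ∨ a = 1 ∧ b = 0) →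
      ((S.filter fun t => IsAdmissible M (Nat.log 2 (N / s ^ 3)) (Nat.log 2 (N / s)) a
        (exponentsOf t)).card : ℝ) ≤ C * (2 : ℝ) ^ (Real.logb 2 N - 6 / 5 * Real.logb 2 s) *
          (M + 2) ^ 6 := by
    intro a b hab
    have h1 := card_le_sum_torsorCount (S.filter fun t => IsAdmissible M (Nat.log 2 (N / s ^ 3))
      (Nat.log 2 (N / s)) a (exponentsOf t)) fun t ht => hmem t (Finset.mem_filter.1 ht).1
    refine le_trans (by exact_mod_cast h1) (h M (Nat.log 2 (N / s ^ 3)) (Nat.log 2 (N / s)) _ _ a b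
      _ e0 e3 e1 (Nat.log_mono_right (Nat.div_le_self _ _))
      (Nat.log_mono_right (Nat.div_le_self _ _)) hσ hab ?_)
    intro k hk
    obtain ⟨t, ht, rfl⟩ := Finset.mem_image.1 hk
    exact (Finset.mem_filter.1 ht).2
  have hpow : (2 : ℝ) ^ (Real.logb 2 N - 6 / 5 * Real.logb 2 s) = N * (s : ℝ) ^ (-6 / 5 : ℝ) := by
    rw [sub_eq_add_neg, Real.rpow_add two_pos, Real.rpow_logb two_pos (by norm_num) hN',
      show -(6 / 5 * Real.logb 2 (s : ℝ)) = Real.logb 2 s * (-6 / 5) by ring,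
      Real.rpow_mul zero_le_two, Real.rpow_logb two_pos (by norm_num) hs']
  have hsub : S ⊆ (S.filter fun t => IsAdmissible M (Nat.log 2 (N / s ^ 3)) (Nat.log 2 (N / s)) 0
      (exponentsOf t)) ∪ (S.filter fun t => IsAdmissible M (Nat.log 2 (N / s ^ 3))
        (Nat.log 2 (N / s)) 1 (exponentsOf t)) := by
    intro t ht
    rw [← Finset.filter_or]
    exact Finset.mem_filter.2 ⟨ht, isAdmissible_exponentsOf hs (hmem t ht)⟩
  have hcard := (Finset.card_le_card hsub).trans (Finset.card_union_le _ _)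
  rw [Set.ncard_eq_toFinset_card _ hfin]
  have k0 := key 0 1 (Or.inl ⟨rfl, rfl⟩)
  have k1 := key 1 0 (Or.inr ⟨rfl, rfl⟩)
  rw [hpow] at k0 k1
  have hcard' := (Nat.cast_le (α := ℝ)).2 hcard
  push_cast at hcard'
  refine hcard'.trans ((add_le_add k0 k1).trans (le_of_eq ?_))
  ring

/-- The torsor points `(s, u, w, y, z)` with the scaling factor `s` included. -/
def torsorPoints (N : ℕ) : Set (ℕ × ℕ × (Fin 3 → ℕ) × (Fin 3 → ℕ) × (Fin 3 → ℕ)) :=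
  {t | 0 < t.1 ∧ t.2 ∈ torsorFiber N t.1}

theorem exists_ncard_torsorPoints_le : ∃ C : ℝ, 0 < C ∧ ∀ N : ℕ, (torsorPoints N).Finite ∧
    ((torsorPoints N).ncard : ℝ) ≤ C * N * (Nat.log 2 N + 2) ^ 6 := by
  classical
  obtain ⟨C, hC, h⟩ := exists_ncard_torsorFiber_le
  have hsum : Summable fun n : ℕ => (n : ℝ) ^ (-6 / 5 : ℝ) :=
    Real.summable_nat_rpow.2 (by norm_num)
  have hT : 0 ≤ ∑' n : ℕ, (n : ℝ) ^ (-6 / 5 : ℝ) := tsum_nonneg fun n => by positivity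
  refine ⟨C * (1 + ∑' n : ℕ, (n : ℝ) ^ (-6 / 5 : ℝ)), by positivity, fun N => ?_⟩
  have hfin : ∀ s, 0 < s → (torsorFiber N s).Finite := torsorFiber_finite N
  let f : ℕ → Finset (ℕ × ℕ × (Fin 3 → ℕ) × (Fin 3 → ℕ) × (Fin 3 → ℕ)) := fun s =>
    if hs : 0 < s then (hfin s hs).toFinset.image (Prod.mk s) else ∅
  have hsub : torsorPoints N ⊆ ((Finset.Icc 1 N).biUnion f : Finset _) := by
    rintro ⟨s, t⟩ ⟨hs, ht⟩
    simp only at hs ht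
    have hsN : s ≤ N := by
      obtain ⟨-, -, -, hz, -, -, hD, -⟩ := ht
      have : 0 < t.2.2.2 0 * t.2.2.2 1 * t.2.2.2 2 :=
        Nat.mul_pos (Nat.mul_pos (hz 0) (hz 1)) (hz 2)
      exact (Nat.le_self_pow three_ne_zero s).trans ((Nat.le_mul_of_pos_right _ this).trans hD)
    simp only [Finset.coe_biUnion, Set.mem_iUnion, Finset.mem_coe]
    refine ⟨s, Finset.mem_Icc.2 ⟨hs, hsN⟩, ?_⟩
    simp only [f, dif_pos hs]
    exact Finset.mem_image_of_mem _ ((hfin s hs).mem_toFinset.2 ht)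
  refine ⟨(Finset.finite_toSet _).subset hsub, ?_⟩
  have h1 := (Set.ncard_le_ncard hsub (Finset.finite_toSet _))
  rw [Set.ncard_coe_finset] at h1
  have h2 : ∀ s ∈ Finset.Icc 1 N, ((f s).card : ℝ) ≤
      C * N * (s : ℝ) ^ (-6 / 5 : ℝ) * (Nat.log 2 N + 2) ^ 6 := by
    intro s hs
    have hs0 : 0 < s := (Finset.mem_Icc.1 hs).1
    refine le_trans ?_ (h N s hs0)
    simp only [f, dif_pos hs0]
    rw [Set.ncard_eq_toFinset_card _ (hfin s hs0)]
    exact_mod_cast Finset.card_image_le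
  calc ((torsorPoints N).ncard : ℝ) ≤ ∑ s ∈ Finset.Icc 1 N, ((f s).card : ℝ) := by
        exact_mod_cast h1.trans Finset.card_biUnion_le
    _ ≤ ∑ s ∈ Finset.Icc 1 N, C * N * (s : ℝ) ^ (-6 / 5 : ℝ) * (Nat.log 2 N + 2) ^ 6 :=
        Finset.sum_le_sum h2
    _ = C * N * (∑ s ∈ Finset.Icc 1 N, (s : ℝ) ^ (-6 / 5 : ℝ)) * (Nat.log 2 N + 2) ^ 6 := by
        rw [Finset.mul_sum, Finset.sum_mul]
    _ ≤ C * N * (1 + ∑' n : ℕ, (n : ℝ) ^ (-6 / 5 : ℝ)) * (Nat.log 2 N + 2) ^ 6 := by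
        gcongr
        have := hsum.sum_le_tsum (Finset.Icc 1 N) fun n _ => by positivity
        linarith
    _ = _ := by ring

/-! ### From the surface to the torsor -/

/-- The integer vector with torsor coordinates `(s, u, w, y, z)`; with the right signs it lies on
the surface. The index `j` tells which of `x₁`, `x₂`, `x₁ + x₂` is largest in absolute value, and
the units are the signs. -/
def torsorMap (j : Fin 3) (δ η ζ : ℤˣ)
    (t : ℕ × ℕ × (Fin 3 → ℕ) × (Fin 3 → ℕ) × (Fin 3 → ℕ)) : Fin 4 → ℤ :=
  let W : ℤ := t.2.2.1 0 * t.2.2.1 1 * t.2.2.1 2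
  let A : Fin 3 → ℤ := fun i =>
    t.1 * t.2.1 ^ 2 * W * (t.2.2.1 i * t.2.2.2.1 i ^ 2 * t.2.2.2.2 i)
  let a : ℤ := δ * ![A 0, A 0 + A 1, A 0] j
  let b : ℤ := δ * ![A 1, -A 0, -(A 0 + A 1)] j
  let c : ℤ := η * (t.2.1 ^ 3 * W ^ 2 * (t.2.2.2.1 0 * t.2.2.2.1 1 * t.2.2.2.1 2))
  ![a, b, c - a - b, ζ * (t.1 ^ 3 * (t.2.2.2.2 0 * t.2.2.2.2 1 * t.2.2.2.2 2))]

theorem exists_unit_mul_natAbs (n : ℤ) : ∃ ε : ℤˣ, n = ε * (n.natAbs : ℤ) := by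
  rcases Int.natAbs_eq n with h | h
  · exact ⟨1, by simpa using h⟩
  · exact ⟨-1, by simpa using h⟩

/-- Of `a`, `b`, `a + b`, the largest in absolute value is the sum of the absolute values of the
others. -/
theorem exists_pos_pair {a b : ℤ} (ha : a ≠ 0) (hb : b ≠ 0) (hab : a + b ≠ 0) :
    ∃ (j : Fin 3) (δ : ℤˣ) (m n : ℕ), 0 < m ∧ 0 < n ∧
      a = δ * (![(m : ℤ), m + n, m] j) ∧ b = δ * (![(n : ℤ), -m, -(m + n)] j) := by
  rcases lt_or_gt_of_ne ha with ha | ha <;> rcases lt_or_gt_of_ne hb with hb | hb <;>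
    rcases lt_or_gt_of_ne hab with hab | hab
  · exact ⟨0, -1, a.natAbs, b.natAbs, by omega, by omega, by simp [-Nat.cast_natAbs]; omega,
      by simp [-Nat.cast_natAbs]; omega⟩
  · omega
  · exact ⟨1, -1, b.natAbs, (a + b).natAbs, by omega, by omega, by simp [-Nat.cast_natAbs]; omega,
      by simp [-Nat.cast_natAbs]; omega⟩
  · exact ⟨2, -1, a.natAbs, (a + b).natAbs, by omega, by omega, by simp [-Nat.cast_natAbs]; omega,
      by simp [-Nat.cast_natAbs]; omega⟩
  · exact ⟨2, 1, a.natAbs, (a + b).natAbs, by omega, by omega, by simp [-Nat.cast_natAbs]; omega,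
      by simp [-Nat.cast_natAbs]; omega⟩
  · exact ⟨1, 1, b.natAbs, (a + b).natAbs, by omega, by omega, by simp [-Nat.cast_natAbs]; omega,
      by simp [-Nat.cast_natAbs]; omega⟩
  · omega
  · exact ⟨0, 1, a.natAbs, b.natAbs, by omega, by omega, by simp [-Nat.cast_natAbs]; omega,
      by simp [-Nat.cast_natAbs]; omega⟩

theorem natAbs_unit_mul (ε : ℤˣ) (n : ℤ) : ((ε : ℤ) * n).natAbs = n.natAbs := by
  rw [Int.natAbs_mul, Int.units_natAbs, one_mul]

/-- The torsor covers the points of the surface off its lines; the sum `x₁ + x₂ + x₃` plays the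
role of a coordinate, which costs a factor `3` in the height. -/
theorem exists_torsorMap_eq {n : ℕ} {x : Fin 4 → ℤ} (hx : IsPrimitive x) (hn : maxNorm x ≤ n)
    (hF : x 0 * x 1 * (x 0 + x 1) + x 3 * (x 0 + x 1 + x 2) ^ 2 = 0)
    (h3 : x 3 ≠ 0) (hs : x 0 + x 1 + x 2 ≠ 0) :
    ∃ (j : Fin 3) (δ η ζ : ℤˣ), ∃ t ∈ torsorPoints (3 * n), torsorMap j δ η ζ t = x := by
  have hprod : x 0 * x 1 * (x 0 + x 1) ≠ 0 := by
    intro h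
    rw [h, zero_add] at hF
    exact mul_ne_zero h3 (pow_ne_zero 2 hs) hF
  have h01 := mul_ne_zero_iff.1 hprod
  have hx0 := (mul_ne_zero_iff.1 h01.1).1
  have hx1 := (mul_ne_zero_iff.1 h01.1).2
  obtain ⟨j, δ, a, b, ha, hb, hja, hjb⟩ := exists_pos_pair hx0 hx1 h01.2
  obtain ⟨η, hη⟩ := exists_unit_mul_natAbs (x 0 + x 1 + x 2)
  obtain ⟨ζ, hζ⟩ := exists_unit_mul_natAbs (x 3)
  set c := (x 0 + x 1 + x 2).natAbs with hc
  set d := (x 3).natAbs with hd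
  have hle : ∀ i, (x i).natAbs ≤ n := fun i =>
    (Finset.le_sup (f := fun i => (x i).natAbs) (Finset.mem_univ i)).trans hn
  have l0 := hle 0
  have l1 := hle 1
  have l2 := hle 2
  have l3 := hle 3
  have hF' : a * b * (a + b) = d * c ^ 2 := by
    have e : (x 0 * x 1 * (x 0 + x 1)).natAbs = d * c ^ 2 := by
      rw [show x 0 * x 1 * (x 0 + x 1) = -(x 3 * (x 0 + x 1 + x 2) ^ 2) by linear_combination hF,
        Int.natAbs_neg, Int.natAbs_mul, Int.natAbs_pow]
    rw [← e, hja, hjb, ← mul_add, Int.natAbs_mul, Int.natAbs_mul, natAbs_unit_mul,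
      natAbs_unit_mul, natAbs_unit_mul]
    fin_cases j
    · simp only [Fin.zero_eta, Matrix.cons_val_zero, Int.natAbs_natCast]
      norm_cast
    · have e2 : ((a : ℤ) + b + -a) = b := by ring
      simp only [Fin.mk_one, Matrix.cons_val_one, Matrix.cons_val_zero, Int.natAbs_neg,
        Int.natAbs_natCast, e2]
      norm_cast
      ring
    · have e2 : ((a : ℤ) + -(a + b)) = -b := by ring
      simp only [Fin.reduceFinMk, Matrix.cons_val, Int.natAbs_neg, Int.natAbs_natCast, e2]
      norm_cast
      ring
  have hgcd : ∀ p : ℕ, p.Prime → p ∣ a → p ∣ b → p ∣ c → ¬ p ∣ d := by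
    intro p hp pa pb pc pd
    have pa' : (p : ℤ) ∣ a := by exact_mod_cast pa
    have pb' : (p : ℤ) ∣ b := by exact_mod_cast pb
    have d0 : (p : ℤ) ∣ x 0 := by
      rw [hja]
      refine Dvd.dvd.mul_left ?_ _
      fin_cases j
      exacts [pa', dvd_add pa' pb', pa']
    have d1 : (p : ℤ) ∣ x 1 := by
      rw [hjb]
      refine Dvd.dvd.mul_left ?_ _
      fin_cases j
      exacts [pb', (dvd_neg).2 pa', (dvd_neg).2 (dvd_add pa' pb')]
    have d3 : (p : ℤ) ∣ x 3 := Int.natCast_dvd.2 pd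
    have d2 : (p : ℤ) ∣ x 2 := by
      have : (p : ℤ) ∣ x 0 + x 1 + x 2 := Int.natCast_dvd.2 pc
      exact (dvd_add_right (dvd_add d0 d1)).1 this
    have : (p : ℤ) ∣ Finset.univ.gcd x := Finset.dvd_gcd fun i _ => by
      fin_cases i
      exacts [d0, d1, d2, d3]
    rw [show Finset.univ.gcd x = 1 from hx] at this
    exact hp.one_lt.ne' (by exact_mod_cast Int.eq_one_of_dvd_one (by positivity) this)
  have hd0 : 0 < d := Int.natAbs_pos.2 h3
  have hc0 : 0 < c := Int.natAbs_pos.2 hs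
  obtain ⟨s, u, w, y, z, e1, e2, e3, e4, e5, hT⟩ := exists_torsor ha hb hF' hgcd
  have hcN : c ≤ 3 * n := by omega
  have hdN : d ≤ 3 * n := by omega
  have haN : a + b ≤ 3 * n := by
    rcases Int.units_eq_one_or δ with rfl | rfl <;> fin_cases j <;> simp at hja hjb <;> omega
  have hc1 := hc0
  have hd1 := hd0
  rw [e4] at hc1
  rw [e5] at hd1
  have hu0 : 0 < u := Nat.pos_of_ne_zero fun h => by simp [h] at hc1
  have hs0 : 0 < s := Nat.pos_of_ne_zero fun h => by simp [h] at hd1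
  have hw0 : ∀ j, 0 < w j := fun j => Nat.pos_of_ne_zero fun h => by
    fin_cases j <;> simp at h <;> simp [h] at hc1
  have hy0 : ∀ j, 0 < y j := fun j => Nat.pos_of_ne_zero fun h => by
    fin_cases j <;> simp at h <;> simp [h] at hc1
  have hz0 : ∀ j, 0 < z j := fun j => Nat.pos_of_ne_zero fun h => by
    fin_cases j <;> simp at h <;> simp [h] at hd1
  refine ⟨j, δ, η, ζ, (s, u, w, y, z), ⟨hs0, hu0, hw0, hy0, hz0, hT, e4 ▸ hcN, e5 ▸ hdN,
    e3 ▸ haN⟩, ?_⟩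
  have f1 : (a : ℤ) = s * u ^ 2 * (w 0 * w 1 * w 2) * (w 0 * y 0 ^ 2 * z 0) := by
    exact_mod_cast e1
  have f2 : (b : ℤ) = s * u ^ 2 * (w 0 * w 1 * w 2) * (w 1 * y 1 ^ 2 * z 1) := by
    exact_mod_cast e2
  have f4 : (c : ℤ) = u ^ 3 * (w 0 * w 1 * w 2) ^ 2 * (y 0 * y 1 * y 2) := by exact_mod_cast e4
  have f5 : (d : ℤ) = s ^ 3 * (z 0 * z 1 * z 2) := by exact_mod_cast e5
  funext i
  simp only [torsorMap, ← f1, ← f2, ← f4, ← f5, ← hja, ← hjb, ← hη, ← hζ]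
  fin_cases i
  · rfl
  · rfl
  · simp only [Fin.reduceFinMk, Matrix.cons_val]; ring
  · rfl

/-- In terms of an integer representative, a point off the lines has `x₄ ≠ 0` and
`x₁ + x₂ + x₃ ≠ 0`. -/
theorem form_of_represents {x : ℙ ℚ (Fin 4 → ℚ)} (hx : x ∈ pointsOffLines d4Form)
    {v : Fin 4 → ℤ} (hv : Represents v x) :
    v 0 * v 1 * (v 0 + v 1) + v 3 * (v 0 + v 1 + v 2) ^ 2 = 0 ∧ v 3 ≠ 0 ∧
      v 0 + v 1 + v 2 ≠ 0 := by
  obtain ⟨hz, l1, l2, l3, l4, l5, l6⟩ := (mem_pointsOffLines_d4Form x).1 hx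
  have hz' := (isZero_d4Form_iff _).1 hz
  have hr3 : x.rep 3 ≠ 0 := by
    intro h
    rw [h, zero_mul, add_zero] at hz'
    rcases mul_eq_zero.1 hz' with hz' | hz'
    · rcases mul_eq_zero.1 hz' with hz' | hz'
      · exact l1 ⟨hz', h⟩
      · exact l2 ⟨hz', h⟩
    · exact l4 ⟨hz', h⟩
  have hrs : x.rep 0 + x.rep 1 + x.rep 2 ≠ 0 := by
    intro h
    rw [h, zero_pow two_ne_zero, mul_zero, add_zero] at hz'
    rcases mul_eq_zero.1 hz' with hz' | hz'
    · rcases mul_eq_zero.1 hz' with hz' | hz'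
      · exact l5 ⟨hz', h⟩
      · exact l6 ⟨hz', h⟩
    · exact l3 ⟨hz', by rw [hz', zero_add] at h; exact h⟩
  obtain ⟨hv0, hvx⟩ := hv
  obtain ⟨r, hr⟩ := (Projectivization.mk_eq_mk_iff' ℚ _ _ hv0 x.rep_nonzero).1
    (hvx.trans x.mk_rep.symm)
  have hr0 : r ≠ 0 := by
    rintro rfl
    rw [zero_smul] at hr
    exact hv0 hr.symm
  have hvi : ∀ i, (v i : ℚ) = r * x.rep i := fun i => (congrFun hr i).symm
  refine ⟨?_, ?_, ?_⟩
  · have : ((v 0 * v 1 * (v 0 + v 1) + v 3 * (v 0 + v 1 + v 2) ^ 2 : ℤ) : ℚ) = 0 := by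
      push_cast
      rw [hvi, hvi, hvi, hvi]
      linear_combination r ^ 3 * hz'
    exact_mod_cast this
  · have : (v 3 : ℚ) ≠ 0 := by rw [hvi]; exact mul_ne_zero hr0 hr3
    exact_mod_cast this
  · have : ((v 0 + v 1 + v 2 : ℤ) : ℚ) ≠ 0 := by
      push_cast
      rw [hvi, hvi, hvi, ← mul_add, ← mul_add]
      exact mul_ne_zero hr0 hrs
    exact_mod_cast this

/-- Each torsor point gives at most `3 · 2³` points of the surface, by the choices of index and
signs. -/
theorem finite_and_countingFunction_le (B : ℝ) :
    (pointsUpTo (pointsOffLines d4Form) B).Finite ∧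
      countingFunction (pointsOffLines d4Form) B ≤ 24 * (torsorPoints (3 * ⌊B⌋₊)).ncard := by
  classical
  obtain ⟨_, _, hT⟩ := exists_ncard_torsorPoints_le
  have hfin := (hT (3 * ⌊B⌋₊)).1
  let g : (Fin 3 × ℤˣ × ℤˣ × ℤˣ) × (ℕ × ℕ × (Fin 3 → ℕ) × (Fin 3 → ℕ) × (Fin 3 → ℕ)) →
      (Fin 4 → ℤ) := fun v => torsorMap v.1.1 v.1.2.1 v.1.2.2.1 v.1.2.2.2 v.2
  let V : Finset (Fin 4 → ℤ) := ((Finset.univ : Finset (Fin 3 × ℤˣ × ℤˣ × ℤˣ)) ×ˢ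
    hfin.toFinset).image g
  have hVcard : V.card ≤ 24 * (torsorPoints (3 * ⌊B⌋₊)).ncard := by
    refine Finset.card_image_le.trans ?_
    rw [Finset.card_product, Set.ncard_eq_toFinset_card _ hfin]
    exact Nat.mul_le_mul_right _ (by simp [Fintype.card_prod, Fintype.card_units_int])
  choose ρ hρp hρr using fun x : ℙ ℚ (Fin 4 → ℚ) => exists_primitive_represents x
  have hmaps : ∀ x ∈ pointsUpTo (pointsOffLines d4Form) B, ρ x ∈ (V : Set (Fin 4 → ℤ)) := by
    rintro x ⟨hx, hB⟩
    obtain ⟨f1, f2, f3⟩ := form_of_represents hx (hρr x)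
    rw [height_eq (hρp x) (hρr x)] at hB
    obtain ⟨j, δ, η, ζ, t, ht, he⟩ :=
      exists_torsorMap_eq (hρp x) (Nat.le_floor hB) f1 f2 f3
    exact Finset.mem_coe.2 (Finset.mem_image.2 ⟨((j, δ, η, ζ), t), Finset.mem_product.2
      ⟨Finset.mem_univ _, hfin.mem_toFinset.2 ht⟩, he⟩)
  have hinj : Set.InjOn ρ (pointsUpTo (pointsOffLines d4Form) B) := by
    intro x _ x' _ h
    obtain ⟨h1, h2⟩ := hρr x
    obtain ⟨h1', h2'⟩ := hρr x'
    rw [← h2, ← h2']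
    simp only [h]
  refine ⟨Set.Finite.of_injOn hmaps hinj V.finite_toSet, ?_⟩
  refine (Set.ncard_le_ncard_of_injOn ρ hmaps hinj V.finite_toSet).trans ?_
  rw [Set.ncard_coe_finset]
  exact hVcard

end D4Cubic

theorem mainTheorem3 :
    (∀ B : ℝ, (D4Cubic.pointsUpTo (D4Cubic.pointsOffLines D4Cubic.d4Form) B).Finite) ∧
    ∃ C : ℝ, 0 < C ∧ ∃ B₀ : ℝ, ∀ B : ℝ, B₀ ≤ B →
      (D4Cubic.countingFunction (D4Cubic.pointsOffLines D4Cubic.d4Form) B : ℝ) ≤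
        C * (B * Real.log B ^ 6) := by
  refine ⟨fun B => (D4Cubic.finite_and_countingFunction_le B).1, ?_⟩
  obtain ⟨C, hC, h⟩ := D4Cubic.exists_ncard_torsorPoints_le
  refine ⟨24 * (C * 3) * 6 ^ 6, by positivity, 3, fun B hB => ?_⟩
  have hB0 : 0 ≤ B := by linarith
  have h1 := (D4Cubic.finite_and_countingFunction_le B).2
  have h2 := (h (3 * ⌊B⌋₊)).2
  -- `3 B` bounds the absolute value of `x₁ + x₂ + x₃`
  set N := 3 * ⌊B⌋₊ with hN
  have hfl : 0 < ⌊B⌋₊ := Nat.floor_pos.2 (by linarith)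
  have hNB : (N : ℝ) ≤ 3 * B := by
    rw [hN]
    push_cast
    linarith [Nat.floor_le hB0]
  have hN0 : 0 < N := by omega
  have hN0' : (0 : ℝ) < N := by exact_mod_cast hN0
  have hlog3 : 1 ≤ Real.log 3 := by
    rw [Real.le_log_iff_exp_le (by norm_num)]
    linarith [Real.exp_one_lt_d9]
  have hlogB : Real.log 3 ≤ Real.log B := Real.log_le_log (by norm_num) hB
  have hlog : (Nat.log 2 N : ℝ) + 2 ≤ 6 * Real.log B := by
    have e1 : (2 : ℝ) ^ Nat.log 2 N ≤ N := by exact_mod_cast Nat.pow_log_le_self 2 hN0.ne'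
    have e2 := Real.log_le_log (by positivity) (e1.trans hNB)
    rw [Real.log_pow, Real.log_mul (by norm_num) (by linarith)] at e2
    have e3 : (1 : ℝ) / 2 ≤ Real.log 2 := by linarith [Real.log_two_gt_d9]
    have e4 : (Nat.log 2 N : ℝ) * (1 / 2) ≤ Nat.log 2 N * Real.log 2 := by gcongr
    linarith
  calc (D4Cubic.countingFunction (D4Cubic.pointsOffLines D4Cubic.d4Form) B : ℝ)
      ≤ 24 * ((D4Cubic.torsorPoints N).ncard : ℝ) := by exact_mod_cast h1
    _ ≤ 24 * (C * N * (Nat.log 2 N + 2) ^ 6) := by gcongr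
    _ ≤ 24 * (C * (3 * B) * (6 * Real.log B) ^ 6) := by gcongr
    _ = _ := by ring
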